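/- **Setting.** Let $\mathcal V$ be a commutative unital quantale (multiplication $\otimes$, unit $k$) that is integral ($k=\top$), whose underlying lattice is continuous and has a basis $B$ (for every $x$ the set $\{y\in B\mid y\ll x\}$ is directed with join $x$, where $\ll$ is the way-below relation) that is closed under finite joins and under $\otimes$ and contains $k$. A $\mathcal V$-category is a set $X$ with $a:X\times X\to\mathcal V$ such that $k\le a(x,x)$ and $a(x,y)\otimes a(y,z)\le a(x,z)$; it is separated if $k\le a(x,y)$ and $k\le a(y,x)$ imply $x=y$; a $\mathcal V$-functor is a map $f$ with $a(x,y)\le b(f(x),f(y))$. A $\mathcal V\text{-}\mathsf{Cat}_{\mathsf{sep}}$-enriched category is a locally small category whose hom-sets are separated $\mathcal V$-categories and whose composition maps $\mathsf C(X,Y)\otimes\mathsf C(Y,Z)\to\mathsf C(X,Z)$ are $\mathcal V$-functors; a functor between such categories is enriched if its action on each hom-set is a $\mathcal V$-functor. A $\mathcal V\text{-}\mathsf{Cat}_{\mathsf{sep}}$-enriched autonomous category is a symmetric monoidal closed category with such an enrichment for which the tensor is an enriched bifunctor and $(-\otimes X)\dashv(X\multimap-)$ is an enriched adjunction (both functors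 are enriched and the transposition bijections are $\mathcal V$-isomorphisms). A linear $\mathcal V\lambda$-theory consists of ground types $G$, operation symbols $f:A_1,\dots,A_n\to A$ ($n\ge1$) over the types $A::=X\in G\mid I\mid A\otimes A\mid A\multimap A$, and a class $Ax$ of $\mathcal V$-equations-in-context $\Gamma\rhd v=_q w:A$ with $q\in B$ between terms of the linear $\lambda$-calculus (variables, $f(v_1,\dots,v_n)$, $\ast$, $v\ \mathtt{to}\ \ast.\,w$, $v\otimes w$, $\mathtt{pm}\ v\ \mathtt{to}\ x\otimes y.\,w$, $\lambda x{:}A.\,v$, $v\,w$; contexts of subterms are combined by shuffles). Its theorems form the smallest class of $\mathcal V$-equations that contains $Ax$; contains, with label $\top$ and in both directions, the equations $$\mathtt{pm}\ v\otimes w\ \mathtt{to}\ x\otimes y.\,u=u[v/x,w/y],\quad \mathtt{pm}\ v\ \mathtt{to}\ x\otimes y.\,u[x\otimes y/z]=u[v/z],\quad \ast\ \mathtt{to}\ \ast.\,v=v,\quad v\ \mathtt{to}\ \ast.\,w[\ast/z]=w[v/z],$$ $$(\lambda x{:}A.\,v)\,w=v[w/x],\quad \lambda x{:}A.\,(v\,x)=v,\quad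 u[v\ \mathtt{to}\ \ast.\,w/z]=v\ \mathtt{to}\ \ast.\,u[w/z],\quad u[\mathtt{pm}\ v\ \mathtt{to}\ x\otimes y.\,w/z]=\mathtt{pm}\ v\ \mathtt{to}\ x\otimes y.\,u[w/z];$$ and is closed under: $v=_\top v$; from $v=_qw$ and $w=_ru$ infer $v=_{q\otimes r}u$; from $v=_qw$ and $r\le q$ infer $v=_rw$; from $v=_rw$ for all $r\ll q$ infer $v=_qw$ (all labels in $B$); from $v=_{q_i}w$ for $i\le n$ infer $v=_{\bigvee_i q_i}w$ (also for $n=0$); compatibility with every term constructor and with substitution, the labels of the premises being multiplied; and permutation of the context. For a theory $T$, the syntactic category $\mathrm{Syn}(T)$ has the types as objects. Its hom-object from $A$ to $A'$ is the separated quotient of the terms $x:A\rhd v:A'$ under $a(v,w)=\bigvee\{q\mid v=_qw\text{ is a theorem of }T\}$, the identity is $[x]$, and composition is substitution, $[v]\cdot[w]=[v[w/x]]$. For a $\mathcal V\text{-}\mathsf{Cat}_{\mathsf{sep}}$-enriched autonomous category $\mathsf C$, the theory $\mathrm{Lang}(\mathsf C)$ has as ground types the objects of $\mathsf C$ and as operation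 symbols all morphisms $f:X\to Y$ of $\mathsf C$ together with symbols $A\to i(A)$ and $i(A)\to A$ for every type $A$, where $i(A)$ is the object of $\mathsf C$ obtained by reading $I,\otimes,\multimap$ in $\mathsf C$. Its axioms are all $\mathcal V$-equations-in-context $\Gamma\rhd v=_qw:A$ (with $q\in B$) that are satisfied in $\mathsf C$, that is, $q\le a([\![v]\!],[\![w]\!])$ in $\mathsf C([\![\Gamma]\!],[\![A]\!])$ for the interpretation in which objects and morphisms of $\mathsf C$ denote themselves and the symbols $A\to i(A)$, $i(A)\to A$ denote identities. **Theorem (Internal language).** For every $\mathcal V\text{-}\mathsf{Cat}_{\mathsf{sep}}$-enriched autonomous category $\mathsf C$, the category $\mathrm{Syn}(\mathrm{Lang}(\mathsf C))$ is locally small, and there is a $\mathcal V\text{-}\mathsf{Cat}_{\mathsf{sep}}$-enriched equivalence of categories $\mathrm{Syn}(\mathrm{Lang}(\mathsf C))\simeq\mathsf C$, i.e. an equivalence of categories both of whose functors are $\mathcal V\text{-}\mathsf{Cat}_{\mathsf{sep}}$-enriched. -/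

import Mathlib

universe w u v

open CategoryTheory MonoidalCategory

namespace VLam

/-! ### Quantales: the way-below relation and bases

A commutative unital quantale `V` is given by `[CommMonoid V] [CompleteLattice V] [IsQuantale V]`:
the tensor of the quantale is `*` and its unit `k` is `1`. -/

section Lattice

variable {L : Type w} [CompleteLattice L]

/-- `y ≪ x`. -/
def WayBelow (y x : L) : Prop :=
  ∀ X : Set L, x ≤ sSup X → ∃ A : Finset L, (A : Set L) ⊆ X ∧ y ≤ A.sup id

/-- Every element is the join of the elements way below it. -/
def IsContinuousLattice (L : Type w) [CompleteLattice L] : Prop :=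
  ∀ x : L, x = sSup {y | WayBelow y x}

/-- For every `x`, the set of elements of `B` way below `x` is directed, with join `x`. -/
def IsLatticeBasis (B : Set L) : Prop :=
  ∀ x : L, (B ∩ {y | WayBelow y x}).Nonempty ∧
    DirectedOn (· ≤ ·) (B ∩ {y | WayBelow y x}) ∧ IsLUB (B ∩ {y | WayBelow y x}) x

/-- A basis that is closed under finite joins (the empty one included) and under the
multiplication of the quantale, and that contains the unit. -/
structure IsQuantaleBasis {V : Type w} [CommMonoid V] [CompleteLattice V] (B : Set V) : Prop where
  basis : IsLatticeBasis B
  sup_mem : ∀ s : Finset V, (s : Set V) ⊆ B → s.sup id ∈ B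
  mul_mem : ∀ q ∈ B, ∀ r ∈ B, q * r ∈ B
  one_mem : (1 : V) ∈ B

end Lattice

/-! ### `V`-categories -/

section VCat

variable (V : Type w) [CommMonoid V] [CompleteLattice V]

/-- The structure of a `V`-category on `X`. -/
class VCat (X : Type u) where
  dist : X → X → V
  one_le_dist : ∀ x, 1 ≤ dist x x
  dist_mul_dist_le : ∀ x y z, dist x y * dist y z ≤ dist x z

/-- The natural order of a `V`-category is antisymmetric. -/
def VCat.IsSeparated (X : Type u) [VCat V X] : Prop :=
  ∀ x y : X, 1 ≤ VCat.dist (V := V) x y → 1 ≤ VCat.dist (V := V) y x → x = y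

/-- `V`-functors between `V`-categories. -/
def IsVFunctor {X : Type u} {Y : Type v} [VCat V X] [VCat V Y] (f : X → Y) : Prop :=
  ∀ x y : X, VCat.dist (V := V) x y ≤ VCat.dist (V := V) (f x) (f y)

variable [IsQuantale V]

theorem vmul_le_vmul {V : Type w} [CommMonoid V] [CompleteLattice V] [IsQuantale V]
    {a b c d : V} (h : a ≤ b) (h' : c ≤ d) : a * c ≤ b * d :=
  mul_le_mul' h h'

/-- The tensor product of `V`-categories. -/
instance VCat.tensor (X : Type u) (Y : Type v) [VCat V X] [VCat V Y] : VCat V (X × Y) where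
  dist p q := VCat.dist p.1 q.1 * VCat.dist p.2 q.2
  one_le_dist p := by
    simpa using vmul_le_vmul (VCat.one_le_dist (V := V) p.1) (VCat.one_le_dist (V := V) p.2)
  dist_mul_dist_le p q r := by
    rw [mul_mul_mul_comm]
    exact vmul_le_vmul (VCat.dist_mul_dist_le _ _ _) (VCat.dist_mul_dist_le _ _ _)

/-- `x ∼ y` iff `x ≤ y` and `y ≤ x` in the natural order. -/
def VCat.setoid (X : Type u) [VCat V X] : Setoid X where
  r x y := 1 ≤ VCat.dist (V := V) x y ∧ 1 ≤ VCat.dist (V := V) y x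
  iseqv :=
    { refl := fun x => ⟨VCat.one_le_dist x, VCat.one_le_dist x⟩
      symm := fun h => ⟨h.2, h.1⟩
      trans := fun {x y z} h h' =>
        ⟨le_trans (by simpa using vmul_le_vmul h.1 h'.1) (VCat.dist_mul_dist_le x y z),
          le_trans (by simpa using vmul_le_vmul h'.2 h.2) (VCat.dist_mul_dist_le z y x)⟩ }

/-- The underlying set of the separated quotient of a `V`-category. -/
def SepQuotient (X : Type u) [VCat V X] : Type u := Quotient (VCat.setoid V X)

theorem VCat.dist_le_of_setoid {X : Type u} [VCat V X] {x x' y y' : X}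
    (h : (VCat.setoid V X).r x x') (h' : (VCat.setoid V X).r y y') :
    VCat.dist (V := V) x y ≤ VCat.dist x' y' := by
  refine le_trans ?_ (VCat.dist_mul_dist_le x' x y')
  refine le_trans ?_ (vmul_le_vmul le_rfl (VCat.dist_mul_dist_le x y y'))
  simpa using vmul_le_vmul h.2 (vmul_le_vmul (le_refl (VCat.dist (V := V) x y)) h'.1)

/-- The separated quotient: `ã([x],[y]) = a(x,y)`. -/
instance SepQuotient.vcat (X : Type u) [VCat V X] : VCat V (SepQuotient V X) where
  dist := Quotient.lift₂ (s₁ := VCat.setoid V X) (s₂ := VCat.setoid V X)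
    (fun x y => VCat.dist (V := V) x y)
    (fun _ _ _ _ h h' => le_antisymm (VCat.dist_le_of_setoid V h h')
      (VCat.dist_le_of_setoid V ((VCat.setoid V X).symm h) ((VCat.setoid V X).symm h')))
  one_le_dist := by
    intro x
    induction x using Quotient.ind
    exact VCat.one_le_dist (V := V) _
  dist_mul_dist_le := by
    intro x y z
    induction x using Quotient.ind
    induction y using Quotient.ind
    induction z using Quotient.ind
    exact VCat.dist_mul_dist_le (V := V) _ _ _

theorem SepQuotient.isSeparated (X : Type u) [VCat V X] :
    VCat.IsSeparated V (SepQuotient V X) := by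
  intro x y
  induction x using Quotient.ind
  induction y using Quotient.ind
  exact fun h h' => Quotient.sound (s := VCat.setoid V X) ⟨h, h'⟩

end VCat

/-! ### Enriched categories -/

section Enriched

variable (V : Type w) [CommMonoid V] [CompleteLattice V] [IsQuantale V]

/-- A category enriched over separated `V`-categories. -/
class VCatSepEnriched (C : Type u) [Category.{v} C] where
  homVCat : ∀ X Y : C, VCat V (X ⟶ Y)
  separated : ∀ X Y : C, VCat.IsSeparated V (X ⟶ Y)
  comp_isVFunctor : ∀ X Y Z : C,
    IsVFunctor V (fun p : (X ⟶ Y) × (Y ⟶ Z) => p.1 ≫ p.2)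

attribute [reducible, instance] VCatSepEnriched.homVCat

/-- Functors between enriched categories that act on hom-objects by `V`-functors. -/
def IsVCatFunctor {C : Type*} {D : Type*} [Category C] [Category D]
    [VCatSepEnriched V C] [VCatSepEnriched V D] (F : C ⥤ D) : Prop :=
  ∀ X Y : C, IsVFunctor V (fun f : X ⟶ Y => F.map f)

/-- An enriched equivalence: a pair of enriched functors, mutually inverse up to
natural isomorphism. (Every natural transformation is `V`-natural here, since equality of
morphisms in hom-objects is equality of elements.) -/
structure VCatSepEquivalence (C : Type*) (D : Type*) [Category C] [Category D]
    [VCatSepEnriched V C] [VCatSepEnriched V D] where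
  equiv : C ≌ D
  functor_isVCatFunctor : IsVCatFunctor V equiv.functor
  inverse_isVCatFunctor : IsVCatFunctor V equiv.inverse

end Enriched

/-! ### Autonomous (symmetric monoidal closed) categories

Mathlib's internal hom is right adjoint to `X ⊗ -`; composing with the symmetry makes it right
adjoint to `- ⊗ X`. The object `X ⊸ Y` is `(ihom X).obj Y`. -/

section Autonomous

variable {C : Type u} [Category.{v} C] [MonoidalCategory C] [SymmetricCategory C]
  [MonoidalClosed C]

/-- The right transpose `X ⟶ (Y ⊸ Z)` of `f : X ⊗ Y ⟶ Z`. -/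
def transpose {X Y Z : C} (f : X ⊗ Y ⟶ Z) : X ⟶ (ihom Y).obj Z :=
  MonoidalClosed.curry ((β_ Y X).hom ≫ f)

/-- The inverse of `transpose`. -/
def untranspose {X Y Z : C} (g : X ⟶ (ihom Y).obj Z) : X ⊗ Y ⟶ Z :=
  (β_ X Y).hom ≫ MonoidalClosed.uncurry g

/-- Application `(X ⊸ Y) ⊗ X ⟶ Y`. -/
def appHom (X Y : C) : (ihom X).obj Y ⊗ X ⟶ Y :=
  (β_ ((ihom X).obj Y) X).hom ≫ (ihom.ev X).app Y

/-- A `V-Cat_sep`-enriched autonomous category: the tensor is an enriched bifunctor and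
`(- ⊗ X) ⊣ (X ⊸ -)` is an enriched adjunction. -/
class VCatSepAutonomous (V : Type w) [CommMonoid V] [CompleteLattice V] [IsQuantale V]
    (C : Type u) [Category.{v} C] [MonoidalCategory C] [SymmetricCategory C] [MonoidalClosed C]
    extends VCatSepEnriched V C where
  tensor_isVFunctor : ∀ X X' Y Y' : C,
    IsVFunctor V (fun p : (X ⟶ X') × (Y ⟶ Y') => p.1 ⊗ₘ p.2)
  whiskerRight_isVFunctor : ∀ X Y Y' : C, IsVFunctor V (fun f : Y ⟶ Y' => f ▷ X)
  ihom_isVFunctor : ∀ X Y Y' : C, IsVFunctor V (fun f : Y ⟶ Y' => (ihom X).map f)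
  transpose_isVFunctor : ∀ X Y Z : C,
    IsVFunctor V (fun f : X ⊗ Y ⟶ Z => transpose f)
  untranspose_isVFunctor : ∀ X Y Z : C,
    IsVFunctor V (fun g : X ⟶ (ihom Y).obj Z => untranspose g)

end Autonomous

/-! ### Shuffles

Contexts are nameless: a context is the list of the types of its (pairwise distinct) variables,
which are referred to by position. Contexts, and lists of argument types, are written from right
to left: the list `A :: Γ` is the context `Γ, x : A`. -/

/-- `Shuffle Γ Δ E`: a way in which `E` arises by interleaving the variables of `Γ` with those of
`Δ`, keeping the relative orders. The constructors `left` and `right` say to which of the two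
contexts the last variable of `E` belongs. -/
inductive Shuffle {T : Type u} : List T → List T → List T → Type u
  | nil : Shuffle [] [] []
  | left {Γ Δ E : List T} (A : T) (s : Shuffle Γ Δ E) : Shuffle (A :: Γ) Δ (A :: E)
  | right {Γ Δ E : List T} (A : T) (s : Shuffle Γ Δ E) : Shuffle Γ (A :: Δ) (A :: E)

namespace Shuffle

variable {T : Type u}

/-- The shuffle `E ∈ Sf(Γ;Δ)`, read as `E ∈ Sf(Δ;Γ)`. -/
def symm : {Γ Δ E : List T} → Shuffle Γ Δ E → Shuffle Δ Γ E
  | _, _, _, nil => nil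
  | _, _, _, left A s => right A s.symm
  | _, _, _, right A s => left A s.symm

def allLeft : (Γ : List T) → Shuffle Γ [] Γ
  | [] => nil
  | A :: Γ => left A (allLeft Γ)

def allRight : (Γ : List T) → Shuffle [] Γ Γ
  | [] => nil
  | A :: Γ => right A (allRight Γ)

/-- The context `Γ, x : A` as a shuffle of `Γ` and `x : A`. -/
def last (Γ : List T) (A : T) : Shuffle Γ [A] (A :: Γ) := right A (allLeft Γ)

/-- A way in which `E` arises by interleaving three contexts, bracketed to the left. -/
structure Three (Γ₁ Γ₂ Γ₃ E : List T) where
  mid : List T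
  inner : Shuffle Γ₁ Γ₂ mid
  outer : Shuffle mid Γ₃ E

/-- The bracketing `Γ₁; (Γ₂; Γ₃)` of three interleaved contexts turned into `(Γ₁; Γ₂); Γ₃`;
every variable of `E` stays in the context it belongs to. -/
def assoc : {Γ₁ Γ₂ Γ₃ Δ E : List T} → Shuffle Γ₂ Γ₃ Δ → Shuffle Γ₁ Δ E → Three Γ₁ Γ₂ Γ₃ E
  | _, _, _, _, _, nil, nil => ⟨_, nil, nil⟩
  | _, _, _, _, _, s, left A t => ⟨_, left A (assoc s t).inner, left A (assoc s t).outer⟩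
  | _, _, _, _, _, left _ s, right A t => ⟨_, right A (assoc s t).inner, left A (assoc s t).outer⟩
  | _, _, _, _, _, right _ s, right A t => ⟨_, (assoc s t).inner, right A (assoc s t).outer⟩

theorem eq_of_nil_left : {Γ E : List T} → Shuffle [] Γ E → Γ = E
  | _, _, nil => rfl
  | _, _, right A s => congrArg (List.cons A) s.eq_of_nil_left

end Shuffle

/-- `CtxPerm E Γ`: the context `E` is a permutation of `Γ`; the last variable of `Γ` may sit
anywhere in `E`, and the remaining ones are permuted likewise. -/
inductive CtxPerm {T : Type u} : List T → List T → Type u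
  | nil : CtxPerm [] []
  | snoc {Γ Δ E : List T} {A : T} (p : CtxPerm Δ Γ) (s : Shuffle Δ [A] E) : CtxPerm E (A :: Γ)

/-! ### Types and terms -/

/-- Types over a class `G` of ground types. -/
inductive Ty (G : Type u) : Type u
  | ground (X : G) : Ty G
  | unit : Ty G
  | tensor (A B : Ty G) : Ty G
  | lolly (A B : Ty G) : Ty G

/-- A class of operation symbols `f : A₁, …, Aₙ → A` with `n ≥ 1`; the list `dom f` is
written from right to left. -/
structure Signature (G : Type u) where
  Op : Type w
  dom : Op → List (Ty G)
  cod : Op → Ty G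
  dom_ne_nil : ∀ f, dom f ≠ []

/-- What stands on the right of a judgement: a single type, or a list of types (for the lists of
arguments of operation symbols, and for simultaneous substitutions). -/
inductive Kind (G : Type u) : Type u
  | tm (A : Ty G) : Kind G
  | args (As : List (Ty G)) : Kind G

/-- Derivations of the judgements `Γ ▹ v : A`. Every judgement has exactly one derivation, and
variables are nameless, so this is the type of terms-in-context up to renaming.

An element of `Expr S E (.args [Aₙ, …, A₁])` is a list of terms `Γᵢ ▹ vᵢ : Aᵢ` together with an
`n`-ary shuffle `E ∈ Sf(Γ₁;…;Γₙ)`, which is given as `E ∈ Sf(E';Γₙ)` for some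
`E' ∈ Sf(Γ₁;…;Γₙ₋₁)`. -/
inductive Expr {G : Type u} (S : Signature.{w} G) : List (Ty G) → Kind G → Type (max u w)
  | hyp (A : Ty G) : Expr S [A] (.tm A)
  | op {E : List (Ty G)} (f : S.Op) (vs : Expr S E (.args (S.dom f))) : Expr S E (.tm (S.cod f))
  | star : Expr S [] (.tm .unit)
  /-- `v to ∗. w` -/
  | letStar {Γ Δ E : List (Ty G)} {A : Ty G} (v : Expr S Γ (.tm .unit)) (w : Expr S Δ (.tm A))
      (s : Shuffle Γ Δ E) : Expr S E (.tm A)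
  | tensor {Γ Δ E : List (Ty G)} {A B : Ty G} (v : Expr S Γ (.tm A)) (w : Expr S Δ (.tm B))
      (s : Shuffle Γ Δ E) : Expr S E (.tm (.tensor A B))
  /-- `pm v to x ⊗ y. w` -/
  | letPair {Γ Δ E : List (Ty G)} {A B D : Ty G} (v : Expr S Γ (.tm (.tensor A B)))
      (w : Expr S (B :: A :: Δ) (.tm D)) (s : Shuffle Γ Δ E) : Expr S E (.tm D)
  | lam {Γ : List (Ty G)} {A B : Ty G} (v : Expr S (A :: Γ) (.tm B)) :
      Expr S Γ (.tm (.lolly A B))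
  | app {Γ Δ E : List (Ty G)} {A B : Ty G} (v : Expr S Γ (.tm (.lolly A B)))
      (w : Expr S Δ (.tm A)) (s : Shuffle Γ Δ E) : Expr S E (.tm B)
  | nil : Expr S [] (.args [])
  | snoc {Γ Δ E : List (Ty G)} {As : List (Ty G)} {A : Ty G} (vs : Expr S Γ (.args As))
      (v : Expr S Δ (.tm A)) (s : Shuffle Γ Δ E) : Expr S E (.args (A :: As))

/-- Terms `Γ ▹ v : A`. -/
abbrev Tm {G : Type u} (S : Signature.{w} G) (Γ : List (Ty G)) (A : Ty G) := Expr S Γ (.tm A)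

/-- Lists of terms, one for each type in `As`, with their contexts shuffled into `E`. -/
abbrev Args {G : Type u} (S : Signature.{w} G) (E As : List (Ty G)) := Expr S E (.args As)

/-! ### Substitution -/

section Subst

variable {G : Type u} {S : Signature.{w} G}

/-- A list of terms for the variables of a shuffle of `Γ` and `Δ`, separated into the terms for
the variables of `Γ` and those for the variables of `Δ`. -/
structure ArgsSplit (S : Signature.{w} G) (Γ Δ E : List (Ty G)) where
  ctx₁ : List (Ty G)
  ctx₂ : List (Ty G)
  fst : Args S ctx₁ Γ
  snd : Args S ctx₂ Δ
  shuffle : Shuffle ctx₁ ctx₂ E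

def Expr.split : {Γ Δ Θ E : List (Ty G)} → Args S E Θ → Shuffle Γ Δ Θ → ArgsSplit S Γ Δ E
  | _, _, _, _, .nil, .nil => ⟨[], [], .nil, .nil, .nil⟩
  | _, _, _, _, .snoc σ v s, .left _ t =>
      let p := Expr.split σ t
      let r := Shuffle.assoc p.shuffle s.symm
      ⟨_, _, .snoc p.fst v r.inner.symm, p.snd, r.outer⟩
  | _, _, _, _, .snoc σ v s, .right _ t =>
      let p := Expr.split σ t
      let r := Shuffle.assoc p.shuffle.symm s.symm
      ⟨_, _, p.fst, .snoc p.snd v r.inner.symm, r.outer.symm⟩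

/-- The term in a list of length one. -/
def Expr.single {E : List (Ty G)} {A : Ty G} : Args S E [A] → Tm S E A
  | .snoc .nil v s => s.eq_of_nil_left ▸ v

/-- Simultaneous substitution of the terms `σ` for all the variables of a context. -/
def Expr.subst : {Γ : List (Ty G)} → {J : Kind G} → Expr S Γ J →
    {E : List (Ty G)} → Args S E Γ → Expr S E J
  | _, _, .hyp _, _, σ => σ.single
  | _, _, .op f vs, _, σ => .op f (vs.subst σ)
  | _, _, .star, _, .nil => .star
  | _, _, .letStar v w s, _, σ =>
      .letStar (v.subst (σ.split s).fst) (w.subst (σ.split s).snd) (σ.split s).shuffle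
  | _, _, .tensor v w s, _, σ =>
      .tensor (v.subst (σ.split s).fst) (w.subst (σ.split s).snd) (σ.split s).shuffle
  | _, _, .letPair (A := A) (B := B) v w s, _, σ =>
      .letPair (v.subst (σ.split s).fst)
        (w.subst (.snoc (.snoc (σ.split s).snd (.hyp A) (.last _ A)) (.hyp B) (.last _ B)))
        (σ.split s).shuffle
  | _, _, .lam (A := A) v, _, σ => .lam (v.subst (.snoc σ (.hyp A) (.last _ A)))
  | _, _, .app v w s, _, σ =>
      .app (v.subst (σ.split s).fst) (w.subst (σ.split s).snd) (σ.split s).shuffle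
  | _, _, .nil, _, .nil => .nil
  | _, _, .snoc vs v s, _, σ =>
      .snoc (vs.subst (σ.split s).fst) (v.subst (σ.split s).snd) (σ.split s).shuffle

/-- The list of the variables of a context. -/
def Expr.vars : (Γ : List (Ty G)) → Args S Γ Γ
  | [] => .nil
  | A :: Γ => .snoc (Expr.vars Γ) (.hyp A) (.last Γ A)

/-- The variables of `Γ`, as terms in a permutation of `Γ`. -/
def CtxPerm.vars : {E Γ : List (Ty G)} → CtxPerm E Γ → Args S E Γ
  | _, _, .nil => .nil
  | _, _, .snoc (A := A) p s => .snoc p.vars (.hyp A) s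

/-- The judgement `E ▹ v : A` obtained from `Γ ▹ v : A` by exchange, where `E` is a permutation
of `Γ`. -/
def Expr.exchange {E Γ : List (Ty G)} {A : Ty G} (v : Tm S Γ A) (p : CtxPerm E Γ) : Tm S E A :=
  v.subst p.vars

/-- `v[w/x]` for the last variable `x : A` of the context `Γ, x : A` of `v`, as a term in a
shuffle of `Γ` and the context of `w`. -/
def Expr.subst₁ {Γ Δ E : List (Ty G)} {A B : Ty G} (v : Tm S (A :: Γ) B) (w : Tm S Δ A)
    (s : Shuffle Γ Δ E) : Tm S E B :=
  v.subst (.snoc (Expr.vars Γ) w s)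

/-- `u[v/x, w/y]` for the last two variables of the context `Γ, x : A, y : B` of `u`. -/
def Expr.subst₂ {Γ Δ₁ Δ₂ E : List (Ty G)} {A B D : Ty G} (u : Tm S (B :: A :: Γ) D)
    (v : Tm S Δ₁ A) (w : Tm S Δ₂ B) (t : Shuffle.Three Γ Δ₁ Δ₂ E) : Tm S E D :=
  u.subst (.snoc (.snoc (Expr.vars Γ) v t.inner) w t.outer)

end Subst

/-! ### Equations -/

section Equations

variable {G : Type u} {S : Signature.{w} G}

/-- The equations-in-context of linear `λ`-calculus. -/
inductive Eqn : {Γ : List (Ty G)} → {A : Ty G} → Tm S Γ A → Tm S Γ A → Prop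
  /-- `pm v ⊗ w to x ⊗ y. u = u[v/x, w/y]` -/
  | pair_beta {Δ₁ Δ₂ Δ Γ E : List (Ty G)} {A B D : Ty G} (v : Tm S Δ₁ A) (w : Tm S Δ₂ B)
      (u : Tm S (B :: A :: Γ) D) (s : Shuffle Δ₁ Δ₂ Δ) (t : Shuffle Δ Γ E) :
      Eqn (.letPair (.tensor v w s) u t) (u.subst₂ v w (Shuffle.assoc s t.symm))
  /-- `pm v to x ⊗ y. u[x ⊗ y/z] = u[v/z]` -/
  | pair_eta {Δ Γ E : List (Ty G)} {A B D : Ty G} (v : Tm S Δ (.tensor A B))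
      (u : Tm S (.tensor A B :: Γ) D) (t : Shuffle Δ Γ E) :
      Eqn (.letPair v
          (u.subst₁ (.tensor (.hyp A) (.hyp B) (.last [A] B)) (.right B (.last Γ A))) t)
        (u.subst₁ v t.symm)
  /-- `∗ to ∗. v = v` -/
  | unit_beta {Γ : List (Ty G)} {A : Ty G} (v : Tm S Γ A) :
      Eqn (.letStar .star v (.allRight Γ)) v
  /-- `v to ∗. w[∗/z] = w[v/z]` -/
  | unit_eta {Δ Γ E : List (Ty G)} {A : Ty G} (v : Tm S Δ .unit) (w : Tm S (.unit :: Γ) A)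
      (t : Shuffle Δ Γ E) :
      Eqn (.letStar v (w.subst₁ .star (.allLeft Γ)) t) (w.subst₁ v t.symm)
  /-- `(λx : A. v) w = v[w/x]` -/
  | lam_beta {Γ Δ E : List (Ty G)} {A B : Ty G} (v : Tm S (A :: Γ) B) (w : Tm S Δ A)
      (t : Shuffle Γ Δ E) :
      Eqn (.app (.lam v) w t) (v.subst₁ w t)
  /-- `λx : A. (v x) = v` -/
  | lam_eta {Γ : List (Ty G)} {A B : Ty G} (v : Tm S Γ (.lolly A B)) :
      Eqn (.lam (.app v (.hyp A) (.last Γ A))) v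
  /-- `u[v to ∗. w/z] = v to ∗. u[w/z]` -/
  | letStar_comm {Γ Δ₁ Δ₂ Δ E : List (Ty G)} {A B : Ty G} (u : Tm S (A :: Γ) B)
      (v : Tm S Δ₁ .unit) (w : Tm S Δ₂ A) (s : Shuffle Δ₁ Δ₂ Δ) (t : Shuffle Γ Δ E) :
      Eqn (u.subst₁ (.letStar v w s) t)
        (.letStar v (u.subst₁ w (Shuffle.assoc s.symm t).inner) (Shuffle.assoc s.symm t).outer.symm)
  /-- `u[pm v to x ⊗ y. w/z] = pm v to x ⊗ y. u[w/z]` -/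
  | letPair_comm {Γ Δ₁ Δ₂ Δ E : List (Ty G)} {A B D D' : Ty G} (u : Tm S (D :: Γ) D')
      (v : Tm S Δ₁ (.tensor A B)) (w : Tm S (B :: A :: Δ₂) D) (s : Shuffle Δ₁ Δ₂ Δ)
      (t : Shuffle Γ Δ E) :
      Eqn (u.subst₁ (.letPair v w s) t)
        (.letPair v
          (u.subst₁ w (.right B (.right A (Shuffle.assoc s.symm t).inner)))
          (Shuffle.assoc s.symm t).outer.symm)

variable {V : Type v} [CommMonoid V] [CompleteLattice V]

/-- Linear `Vλ`-theories over `(G, Σ)`: a class `Ax` of `V`-equations-in-context `Γ ▹ v =_q w : A`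
with labels `q ∈ B`. -/
structure VTheory (S : Signature.{w} G) (B : Set V) where
  Ax : {Γ : List (Ty G)} → {A : Ty G} → V → Tm S Γ A → Tm S Γ A → Prop
  label_mem : ∀ {Γ : List (Ty G)} {A : Ty G} {q : V} {v w : Tm S Γ A}, Ax q v w → q ∈ B

/-- The theorems `Γ ▹ v =_q w : A` of a theory: the smallest class that contains the axioms and
is closed under the equations of linear `λ`-calculus and under the `V`-congruence rules. On lists
of terms, it relates lists that are related componentwise, the label being the product of the
labels of the components. -/
inductive VTheory.Thm {B : Set V} (T : VTheory S B) :
    {Γ : List (Ty G)} → {J : Kind G} → V → Expr S Γ J → Expr S Γ J → Prop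
  | ax {Γ : List (Ty G)} {A : Ty G} {q : V} {v w : Tm S Γ A} (h : T.Ax q v w) : Thm T q v w
  | eqn {Γ : List (Ty G)} {A : Ty G} {v w : Tm S Γ A} (h : Eqn v w) : Thm T ⊤ v w
  | eqn_symm {Γ : List (Ty G)} {A : Ty G} {v w : Tm S Γ A} (h : Eqn v w) : Thm T ⊤ w v
  | refl {Γ : List (Ty G)} {A : Ty G} (v : Tm S Γ A) : Thm T ⊤ v v
  | trans {Γ : List (Ty G)} {A : Ty G} {q r : V} {v w u : Tm S Γ A} (h : Thm T q v w)
      (h' : Thm T r w u) : Thm T (q * r) v u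
  | weak {Γ : List (Ty G)} {A : Ty G} {q r : V} {v w : Tm S Γ A} (h : Thm T q v w)
      (hr : r ∈ B) (hrq : r ≤ q) : Thm T r v w
  | arch {Γ : List (Ty G)} {A : Ty G} {q : V} {v w : Tm S Γ A} (hq : q ∈ B)
      (h : ∀ r ∈ B, WayBelow r q → Thm T r v w) : Thm T q v w
  | join {Γ : List (Ty G)} {A : Ty G} {v w : Tm S Γ A} (s : Finset V)
      (h : ∀ q ∈ s, Thm T q v w) : Thm T (s.sup id) v w
  | args_nil : Thm T 1 Expr.nil Expr.nil
  | args_snoc {Γ Δ E As : List (Ty G)} {A : Ty G} {q r : V} {vs ws : Args S Γ As}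
      {v w : Tm S Δ A} (s : Shuffle Γ Δ E) (h : Thm T q vs ws) (h' : Thm T r v w) :
      Thm T (q * r) (Expr.snoc vs v s) (Expr.snoc ws w s)
  | op {E : List (Ty G)} {q : V} (f : S.Op) {vs ws : Args S E (S.dom f)} (h : Thm T q vs ws) :
      Thm T q (Expr.op f vs) (Expr.op f ws)
  | tensor {Γ Δ E : List (Ty G)} {A A' : Ty G} {q r : V} {v w : Tm S Γ A} {v' w' : Tm S Δ A'}
      (s : Shuffle Γ Δ E) (h : Thm T q v w) (h' : Thm T r v' w') :
      Thm T (q * r) (Expr.tensor v v' s) (Expr.tensor w w' s)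
  | letPair {Γ Δ E : List (Ty G)} {A A' D : Ty G} {q r : V} {v w : Tm S Γ (.tensor A A')}
      {v' w' : Tm S (A' :: A :: Δ) D} (s : Shuffle Γ Δ E) (h : Thm T q v w)
      (h' : Thm T r v' w') : Thm T (q * r) (Expr.letPair v v' s) (Expr.letPair w w' s)
  | letStar {Γ Δ E : List (Ty G)} {A : Ty G} {q r : V} {v w : Tm S Γ .unit} {v' w' : Tm S Δ A}
      (s : Shuffle Γ Δ E) (h : Thm T q v w) (h' : Thm T r v' w') :
      Thm T (q * r) (Expr.letStar v v' s) (Expr.letStar w w' s)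
  | lam {Γ : List (Ty G)} {A A' : Ty G} {q : V} {v w : Tm S (A :: Γ) A'} (h : Thm T q v w) :
      Thm T q (Expr.lam v) (Expr.lam w)
  | app {Γ Δ E : List (Ty G)} {A A' : Ty G} {q r : V} {v w : Tm S Γ (.lolly A A')}
      {v' w' : Tm S Δ A} (s : Shuffle Γ Δ E) (h : Thm T q v w) (h' : Thm T r v' w') :
      Thm T (q * r) (Expr.app v v' s) (Expr.app w w' s)
  | exchange {Γ E : List (Ty G)} {A : Ty G} {q : V} {v w : Tm S Γ A} (p : CtxPerm E Γ)
      (h : Thm T q v w) : Thm T q (v.exchange p) (w.exchange p)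
  | subst {Γ Δ E : List (Ty G)} {A A' : Ty G} {q r : V} {v w : Tm S (A :: Γ) A'}
      {v' w' : Tm S Δ A} (s : Shuffle Γ Δ E) (h : Thm T q v w) (h' : Thm T r v' w') :
      Thm T (q * r) (v.subst₁ v' s) (w.subst₁ w' s)

end Equations

/-! ### The syntactic category -/

section Syn

variable {G : Type u} {S : Signature.{w} G} {V : Type v} [CommMonoid V] [CompleteLattice V]
  [IsQuantale V] {B : Set V}

/-- The class of terms `v` with `x : A ▹ v : A'`. -/
def VTheory.Values (_T : VTheory S B) (A A' : Ty G) := Tm S [A] A'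

/-- `a(v, w) = ⋁ {q | v =_q w is a theorem}`. -/
instance VTheory.valuesVCat (T : VTheory S B) (A A' : Ty G) : VCat V (T.Values A A') where
  dist v w := sSup {q | T.Thm (J := .tm A') q v w}
  one_le_dist v := le_trans le_top (le_sSup (VTheory.Thm.refl (T := T) (A := A') v))
  dist_mul_dist_le v w u := by
    rw [sSup_mul_distrib]
    refine iSup₂_le fun q hq => ?_
    rw [mul_sSup_distrib]
    exact iSup₂_le fun r hr => le_sSup (VTheory.Thm.trans (A := A') hq hr)

/-- The objects of the syntactic category of `T` are the types. -/
structure Syn (T : VTheory S B) where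
  ty : Ty G

/-- The hom-objects of the syntactic category. -/
abbrev VTheory.SynHom (T : VTheory S B) (A A' : Ty G) := SepQuotient V (T.Values A A')

/-- The class of a term. -/
def VTheory.cls (T : VTheory S B) {A A' : Ty G} (v : Tm S [A] A') : T.SynHom A A' :=
  Quotient.mk (VCat.setoid V (T.Values A A')) v

theorem VTheory.cls_eq_cls (T : VTheory S B) {A A' : Ty G} {v w : Tm S [A] A'}
    (h : T.Thm ⊤ v w) (h' : T.Thm ⊤ w v) : T.cls v = T.cls w :=
  Quotient.sound (s := VCat.setoid V (T.Values A A'))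
    ⟨le_trans le_top (le_sSup h), le_trans le_top (le_sSup h')⟩

/-- Composition of terms in one variable: `v[w/x]`. -/
def Expr.comp {A A' A'' : Ty G} (v : Tm S [A'] A'') (w : Tm S [A] A') : Tm S [A] A'' :=
  v.subst₁ w (.allRight [A])

theorem VTheory.comp_isVFunctor (T : VTheory S B) (A A' A'' : Ty G) :
    IsVFunctor V (Y := T.Values A A'') (fun p : T.Values A A' × T.Values A' A'' =>
      Expr.comp (S := S) p.2 p.1) := by
  rintro ⟨w, v⟩ ⟨w', v'⟩
  change sSup {q | T.Thm (J := .tm A') q w w'} * sSup {q | T.Thm (J := .tm A'') q v v'} ≤ _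
  rw [mul_comm, sSup_mul_distrib]
  refine iSup₂_le fun q hq => ?_
  rw [mul_sSup_distrib]
  exact iSup₂_le fun r hr => le_sSup
    (VTheory.Thm.subst (A := A') (A' := A'') (.allRight [A]) hq hr)

/-- `[v] ∘ [w] = [v[w/x]]`. -/
def VTheory.synComp (T : VTheory S B) {A A' A'' : Ty G} (g : T.SynHom A A')
    (f : T.SynHom A' A'') : T.SynHom A A'' :=
  Quotient.map₂ (sa := VCat.setoid V (T.Values A A')) (sb := VCat.setoid V (T.Values A' A''))
    (sc := VCat.setoid V (T.Values A A''))
    (fun w v => Expr.comp (S := S) v w)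
    (fun w w' h v v' h' =>
      ⟨(mul_one (1 : V)).ge.trans
          ((vmul_le_vmul h.1 h'.1).trans (T.comp_isVFunctor A A' A'' (w, v) (w', v'))),
        (mul_one (1 : V)).ge.trans
          ((vmul_le_vmul h.2 h'.2).trans (T.comp_isVFunctor A A' A'' (w', v') (w, v)))⟩) g f

theorem Shuffle.symm_symm {T : Type u} {Γ Δ E : List T} (s : Shuffle Γ Δ E) :
    s.symm.symm = s := by
  induction s <;> simp_all [Shuffle.symm]

theorem Shuffle.symm_allLeft {T : Type u} (Γ : List T) :
    (Shuffle.allLeft Γ).symm = Shuffle.allRight Γ := by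
  induction Γ <;> simp_all [Shuffle.symm, Shuffle.allLeft, Shuffle.allRight]

theorem Shuffle.assoc_allRight {T : Type u} : {Γ Δ E : List T} → (s : Shuffle Γ Δ E) →
    Shuffle.assoc s (Shuffle.allRight E) = ⟨Γ, Shuffle.allRight Γ, s⟩
  | _, _, _, .nil => rfl
  | _, _, _, .left A s => by
      simp only [Shuffle.allRight, Shuffle.assoc]
      rw [Shuffle.assoc_allRight s]
  | _, _, _, .right A s => by
      simp only [Shuffle.allRight, Shuffle.assoc]
      rw [Shuffle.assoc_allRight s]

theorem Shuffle.assoc_last_symm {T : Type u} {Γ Δ E : List T} (s : Shuffle Γ Δ E) (A : T) :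
    Shuffle.assoc s (Shuffle.last E A).symm = ⟨A :: Γ, (Shuffle.last Γ A).symm, .left A s⟩ := by
  simp only [Shuffle.last, Shuffle.symm, Shuffle.symm_allLeft, Shuffle.assoc]
  rw [Shuffle.assoc_allRight s]

theorem Expr.split_vars : {Γ Δ E : List (Ty G)} → (s : Shuffle Γ Δ E) →
    Expr.split (Expr.vars (S := S) E) s = ⟨Γ, Δ, Expr.vars Γ, Expr.vars Δ, s⟩
  | _, _, _, .nil => rfl
  | _, _, _, .left A s => by
      simp only [Expr.vars, Expr.split]
      rw [Expr.split_vars s, Shuffle.assoc_last_symm s A, Shuffle.symm_symm]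
  | _, _, _, .right A s => by
      simp only [Expr.vars, Expr.split]
      rw [Expr.split_vars s, Shuffle.assoc_last_symm s.symm A, Shuffle.symm_symm]
      simp only [Shuffle.symm, Shuffle.symm_symm]

theorem Expr.subst_vars : {Γ : List (Ty G)} → {J : Kind G} → (v : Expr S Γ J) →
    v.subst (Expr.vars Γ) = v := by
  intro Γ J v
  induction v with
  | hyp A => rfl
  | star => rfl
  | nil => rfl
  | op f vs ih => simp [Expr.subst, ih]
  | lam v ih =>
    simp only [Expr.subst]
    exact congrArg Expr.lam ih
  | letStar v w s ih ih' => simp only [Expr.subst]; rw [Expr.split_vars s]; simp [ih, ih']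
  | tensor v w s ih ih' => simp only [Expr.subst]; rw [Expr.split_vars s]; simp [ih, ih']
  | app v w s ih ih' => simp only [Expr.subst]; rw [Expr.split_vars s]; simp [ih, ih']
  | snoc v w s ih ih' => simp only [Expr.subst]; rw [Expr.split_vars s]; simp [ih, ih']
  | letPair v w s ih ih' =>
    simp only [Expr.subst]; rw [Expr.split_vars s]
    simp only [ih]
    exact congrArg (fun x => Expr.letPair v x s) ih'

theorem VTheory.cls_comp_assoc (T : VTheory S B) {A₁ A₂ A₃ A₄ : Ty G} (w : Tm S [A₁] A₂)
    (v : Tm S [A₂] A₃) (u : Tm S [A₃] A₄) :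
    T.cls (Expr.comp (Expr.comp u v) w) = T.cls (Expr.comp u (Expr.comp v w)) := by
  have beta : ∀ {A : Ty G} (t : Tm S [A] A₃),
      T.cls (Expr.app (Expr.lam u) t (.allRight [A])) = T.cls (Expr.comp u t) := fun t =>
    T.cls_eq_cls (.eqn (.lam_beta u t _)) (.eqn_symm (.lam_beta u t _))
  have key : Expr.comp (Expr.app (Expr.lam u) v (.allRight [A₂])) w =
      Expr.app (Expr.lam u) (Expr.comp v w) (.allRight [A₁]) := by
    have h : (Expr.lam u).subst Expr.nil = Expr.lam u := Expr.subst_vars (Expr.lam u)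
    change Expr.app ((Expr.lam u).subst Expr.nil) (Expr.comp v w) _ = _
    rw [h]
    rfl
  calc T.cls (Expr.comp (Expr.comp u v) w)
      = T.synComp (T.cls w) (T.cls (Expr.comp u v)) := rfl
    _ = T.synComp (T.cls w) (T.cls (Expr.app (Expr.lam u) v (.allRight [A₂]))) := by rw [beta]
    _ = T.cls (Expr.comp (Expr.app (Expr.lam u) v (.allRight [A₂])) w) := rfl
    _ = T.cls (Expr.app (Expr.lam u) (Expr.comp v w) (.allRight [A₁])) := by rw [key]
    _ = T.cls (Expr.comp u (Expr.comp v w)) := beta _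

/-- The syntactic category: morphisms are classes of terms `x : A ▹ v : A'`, the identity is the
class of `x : A ▹ x : A`, and composition is substitution. -/
instance Syn.category (T : VTheory S B) : Category (Syn T) where
  Hom X Y := T.SynHom X.ty Y.ty
  id X := T.cls (.hyp X.ty)
  comp f g := T.synComp f g
  id_comp f := by
    induction f using Quotient.ind with
    | _ v => exact congrArg T.cls (Expr.subst_vars (S := S) v)
  comp_id f := by
    induction f using Quotient.ind with
    | _ v => rfl
  assoc f g h := by
    induction f using Quotient.ind with
    | _ w =>
    induction g using Quotient.ind with
    | _ v =>
    induction h using Quotient.ind with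
    | _ u => exact (T.cls_comp_assoc w v u).symm

instance Syn.enriched (T : VTheory S B) : VCatSepEnriched V (Syn T) where
  homVCat X Y := SepQuotient.vcat V (T.Values X.ty Y.ty)
  separated X Y := SepQuotient.isSeparated V (T.Values X.ty Y.ty)
  comp_isVFunctor X Y Z := by
    rintro ⟨f, g⟩ ⟨f', g'⟩
    induction f using Quotient.ind with
    | _ w =>
    induction g using Quotient.ind with
    | _ v =>
    induction f' using Quotient.ind with
    | _ w' =>
    induction g' using Quotient.ind with
    | _ v' => exact T.comp_isVFunctor X.ty Y.ty Z.ty (w, v) (w', v')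

end Syn

/-! ### Interpretation in an autonomous category -/

section Semantics

variable {G : Type w} {C : Type u} [Category.{v} C] [MonoidalCategory C] [SymmetricCategory C]
  [MonoidalClosed C]

/-- `⟦A⟧`, for an interpretation `g` of the ground types. -/
def tyObj (g : G → C) : Ty G → C
  | .ground X => g X
  | .unit => 𝟙_ C
  | .tensor A B => tyObj g A ⊗ tyObj g B
  | .lolly A B => (ihom (tyObj g A)).obj (tyObj g B)

/-- `⟦Γ⟧`, which is `I` if `Γ` is empty and `(… (⟦A₁⟧ ⊗ ⟦A₂⟧) ⊗ …) ⊗ ⟦Aₙ⟧` otherwise. -/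
def ctxObj (g : G → C) : List (Ty G) → C
  | [] => 𝟙_ C
  | [A] => tyObj g A
  | A :: B :: Γ => ctxObj g (B :: Γ) ⊗ tyObj g A

/-- The interpretation of what stands on the right of a judgement. -/
def Kind.obj (g : G → C) : Kind G → C
  | .tm A => tyObj g A
  | .args As => ctxObj g As

/-- The canonical isomorphism `⟦Γ, A⟧ ≅ ⟦Γ⟧ ⊗ ⟦A⟧`. -/
def ctxSnoc (g : G → C) : (Γ : List (Ty G)) → (A : Ty G) →
    (ctxObj g (A :: Γ) ≅ ctxObj g Γ ⊗ tyObj g A)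
  | [], A => (λ_ (tyObj g A)).symm
  | _ :: _, _ => Iso.refl _

/-- The canonical morphism `⟦E⟧ ⟶ ⟦Γ⟧ ⊗ ⟦Δ⟧` for `E ∈ Sf(Γ;Δ)`: the shuffling morphism
`⟦E⟧ ⟶ ⟦Γ, Δ⟧` followed by the splitting morphism `⟦Γ, Δ⟧ ⟶ ⟦Γ⟧ ⊗ ⟦Δ⟧`. -/
def shuffleHom (g : G → C) : {Γ Δ E : List (Ty G)} → Shuffle Γ Δ E →
    (ctxObj g E ⟶ ctxObj g Γ ⊗ ctxObj g Δ)
  | _, _, _, .nil => (λ_ (𝟙_ C)).inv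
  | _, _, _, .left (Γ := Γ) (Δ := Δ) (E := E) A s =>
      (ctxSnoc g E A).hom ≫ (shuffleHom g s ▷ tyObj g A) ≫
        (α_ (ctxObj g Γ) (ctxObj g Δ) (tyObj g A)).hom ≫
        (ctxObj g Γ ◁ (β_ (ctxObj g Δ) (tyObj g A)).hom) ≫
        (α_ (ctxObj g Γ) (tyObj g A) (ctxObj g Δ)).inv ≫
        ((ctxSnoc g Γ A).inv ▷ ctxObj g Δ)
  | _, _, _, .right (Γ := Γ) (Δ := Δ) (E := E) A s =>
      (ctxSnoc g E A).hom ≫ (shuffleHom g s ▷ tyObj g A) ≫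
        (α_ (ctxObj g Γ) (ctxObj g Δ) (tyObj g A)).hom ≫
        (ctxObj g Γ ◁ (ctxSnoc g Δ A).inv)

/-- An interpretation of `(G, Σ)` in `C`: objects for the ground types, and morphisms
`⟦A₁⟧ ⊗ … ⊗ ⟦Aₙ⟧ ⟶ ⟦A⟧` for the operation symbols `f : A₁, …, Aₙ → A`. -/
structure Interpretation (S : Signature G) (C : Type u) [Category.{v} C] [MonoidalCategory C]
    [SymmetricCategory C] [MonoidalClosed C] where
  ob : G → C
  op : ∀ f : S.Op, ctxObj ob (S.dom f) ⟶ tyObj ob (S.cod f)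

/-- The interpretation `⟦Γ ▹ v : A⟧ : ⟦Γ⟧ ⟶ ⟦A⟧` of judgements. A list of terms is interpreted as
`⟦E⟧ ⟶ ⟦Γ₁⟧ ⊗ … ⊗ ⟦Γₙ⟧ ⟶ ⟦A₁⟧ ⊗ … ⊗ ⟦Aₙ⟧`. -/
def Expr.interp {S : Signature G} (M : Interpretation S C) : {Γ : List (Ty G)} → {J : Kind G} →
    Expr S Γ J → (ctxObj M.ob Γ ⟶ J.obj M.ob)
  | _, _, .hyp A => 𝟙 (tyObj M.ob A)
  | _, _, .op f vs => vs.interp M ≫ M.op f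
  | _, _, .star => 𝟙 (𝟙_ C)
  | _, _, .letStar (Δ := Δ) v w s =>
      shuffleHom M.ob s ≫ (v.interp M ▷ ctxObj M.ob Δ) ≫ (λ_ (ctxObj M.ob Δ)).hom ≫ w.interp M
  | _, _, .tensor v w s => shuffleHom M.ob s ≫ (v.interp M ⊗ₘ w.interp M)
  | _, _, .letPair (Δ := Δ) (A := A) (B := B) v w s =>
      shuffleHom M.ob s ≫ (v.interp M ▷ ctxObj M.ob Δ) ≫
        (β_ (tyObj M.ob A ⊗ tyObj M.ob B) (ctxObj M.ob Δ)).hom ≫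
        (α_ (ctxObj M.ob Δ) (tyObj M.ob A) (tyObj M.ob B)).inv ≫
        ((ctxSnoc M.ob Δ A).inv ▷ tyObj M.ob B) ≫ (ctxSnoc M.ob (A :: Δ) B).inv ≫ w.interp M
  | _, _, .lam (Γ := Γ) (A := A) v => transpose ((ctxSnoc M.ob Γ A).inv ≫ v.interp M)
  | _, _, .app (A := A) (B := B) v w s =>
      shuffleHom M.ob s ≫ (v.interp M ⊗ₘ w.interp M) ≫ appHom (tyObj M.ob A) (tyObj M.ob B)
  | _, _, .nil => 𝟙 (𝟙_ C)
  | _, _, .snoc (As := As) (A := A) vs v s =>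
      shuffleHom M.ob s ≫ (vs.interp M ⊗ₘ v.interp M) ≫ (ctxSnoc M.ob As A).inv

/-- The interpretation satisfies the `V`-equation `Γ ▹ v =_q w : A`. -/
def Interpretation.Satisfies {S : Signature G} (M : Interpretation S C) (V : Type*) [CommMonoid V]
    [CompleteLattice V] [IsQuantale V] [VCatSepEnriched V C] {Γ : List (Ty G)} {A : Ty G} (q : V)
    (v w : Tm S Γ A) : Prop :=
  q ≤ VCat.dist (V := V) (v.interp M) (w.interp M)

end Semantics

/-! ### The internal language -/

section Lang

variable (C : Type u) [Category.{v} C] [MonoidalCategory C] [SymmetricCategory C]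
  [MonoidalClosed C]

/-- The operation symbols of the internal language of `C`: the morphisms of `C`, as unary symbols
between ground types, and for each type `A` symbols `A → i(A)` and `i(A) → A` (for the isomorphism
`A ≃ i(A)`), where `i(A)` is the object of `C` obtained from `A` by applying the structure of
`C`. -/
inductive LangOp : Type (max u v)
  | mor {X Y : C} (f : X ⟶ Y) : LangOp
  | toObj (A : Ty C) : LangOp
  | ofObj (A : Ty C) : LangOp

/-- The signature of the internal language of `C`. Its ground types are the objects of `C`. -/
def langSignature : Signature C where
  Op := LangOp C
  dom
    | .mor (X := X) _ => [.ground X]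
    | .toObj A => [A]
    | .ofObj A => [.ground (tyObj id A)]
  cod
    | .mor (Y := Y) _ => .ground Y
    | .toObj A => .ground (tyObj id A)
    | .ofObj A => A
  dom_ne_nil f := by cases f <;> simp

/-- The obvious interpretation of the internal language in `C`: objects and morphisms of `C` are
interpreted as themselves. Since `⟦A⟧ = i(A)`, the isomorphisms `A ≃ i(A)` are interpreted as
identities. -/
def langInterpretation : Interpretation (langSignature C) C where
  ob := id
  op
    | .mor f => f
    | .toObj A => 𝟙 (tyObj id A)
    | .ofObj A => 𝟙 (tyObj id A)

/-- The internal language of `C`: the axioms are all the `V`-equations-in-context (with labels in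
`B`) that are satisfied by the obvious interpretation in `C`. -/
def Lang {V : Type w} [CommMonoid V] [CompleteLattice V] [IsQuantale V] (B : Set V)
    [VCatSepEnriched V C] : VTheory (langSignature C) B where
  Ax q v w := q ∈ B ∧ (langInterpretation C).Satisfies V q v w
  label_mem h := h.1

end Lang

end VLam

/-!
The equivalence is the interpretation functor `Lang.interpFunctor`, which sends a type `A` to its
denotation `i(A)` and the class of a term `x : A ▹ v : A'` to `⟦v⟧ : i(A) ⟶ i(A')`. Everything
follows from the fact that it is an isometry on hom-objects (`Lang.dist_eq`): the distance
`⋁ {q | v =_q w is a theorem}` in the syntactic category equals the distance of `⟦v⟧` and `⟦w⟧`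
in `C`.

One inequality is cheap. The axioms of the internal language are all the valid `V`-equations with
labels in `B`, and the distance of `⟦v⟧` and `⟦w⟧` is the join of the elements of `B` way below it.

The other inequality is soundness (`VTheory.Thm.le_dist`): the label of a theorem is at most the
distance of the interpretations. The congruence rules hold because composition, tensor and
transposition are `V`-functors. The equations of linear `λ`-calculus and the rules for substitution
and exchange reduce to the statement that substitution is interpreted as composition
(`Expr.interp_subst`), which in turn rests on the compatibility of splitting a list of terms with
the shuffling morphisms (`argsHom_split`). The coherence content is that the shuffling morphisms
turn the symmetry and the reassociation of shuffles into the braiding and the associator of `C`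
(`shuffleHom_symm`, `shuffleHom_assoc`).

An isometry between separated `V`-categories is injective, so the functor is well defined on classes
and faithful, and the hom-sets of the syntactic category are small. It is full because
`f : i(A) ⟶ i(A')` is the denotation of the term that applies the symbols `A → i(A)`, `f` and
`i(A') → A'` in turn, and it is surjective on objects because every object is a ground type. Its
inverse is enriched since conjugation by isomorphisms does not decrease distances.
-/

namespace VLam

/-! ### Shuffles as morphisms of a symmetric monoidal category -/

section RightComm

variable {C : Type u} [Category.{v} C] [MonoidalCategory C] [SymmetricCategory C]

/-- The canonical morphism `(X ⊗ Y) ⊗ Z ⟶ (X ⊗ Z) ⊗ Y`. -/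
def rightComm (X Y Z : C) : (X ⊗ Y) ⊗ Z ⟶ (X ⊗ Z) ⊗ Y :=
  (α_ X Y Z).hom ≫ X ◁ (β_ Y Z).hom ≫ (α_ X Z Y).inv

theorem rightComm_naturality {X X' Y Y' Z Z' : C} (f : X ⟶ X') (h : Y ⟶ Y') (k : Z ⟶ Z') :
    ((f ⊗ₘ h) ⊗ₘ k) ≫ rightComm X' Y' Z' = rightComm X Y Z ≫ ((f ⊗ₘ k) ⊗ₘ h) := by
  simp only [rightComm, associator_naturality_assoc, Category.assoc, ← associator_inv_naturality]
  simp only [← id_tensorHom, tensorHom_comp_tensorHom_assoc, Category.id_comp, Category.comp_id,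
    BraidedCategory.braiding_naturality]

theorem rightComm_naturality_left {X X' : C} (f : X ⟶ X') (Y Z : C) :
    (f ▷ Y) ▷ Z ≫ rightComm X' Y Z = rightComm X Y Z ≫ (f ▷ Z) ▷ Y := by
  simpa using rightComm_naturality f (𝟙 Y) (𝟙 Z)

theorem rightComm_naturality_middle (X : C) {Y Y' : C} (f : Y ⟶ Y') (Z : C) :
    (X ◁ f) ▷ Z ≫ rightComm X Y' Z = rightComm X Y Z ≫ (X ⊗ Z) ◁ f := by
  simpa using rightComm_naturality (𝟙 X) f (𝟙 Z)

theorem symmetry_whiskerRight (X Y Z : C) : (β_ X Y).hom ▷ Z ≫ (β_ Y X).hom ▷ Z = 𝟙 _ := by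
  rw [← comp_whiskerRight, SymmetricCategory.symmetry, id_whiskerRight]

theorem whiskerLeft_symmetry (X Y Z : C) : X ◁ (β_ Y Z).hom ≫ X ◁ (β_ Z Y).hom = 𝟙 _ := by
  rw [← whiskerLeft_comp, SymmetricCategory.symmetry, whiskerLeft_id]

theorem rightComm_braiding (X Y Z : C) :
    rightComm X Y Z ≫ (β_ (X ⊗ Z) Y).hom = (β_ X Y).hom ▷ Z ≫ (α_ Y X Z).hom := by
  simp [rightComm, BraidedCategory.braiding_tensor_left_hom, reassoc_of% @whiskerLeft_symmetry]

theorem associator_braiding_tensor (X Y Z : C) :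
    (α_ X Y Z).hom ≫ (β_ X (Y ⊗ Z)).hom = (β_ X Y).hom ▷ Z ≫ rightComm Y X Z := by
  simp [rightComm, BraidedCategory.braiding_tensor_right_hom]

/-- A form of the hexagon identity. -/
theorem rightComm_tensor (X Y W A : C) :
    (α_ X Y W).inv ▷ A ≫ rightComm (X ⊗ Y) W A ≫ rightComm X Y A ▷ W =
      rightComm X (Y ⊗ W) A ≫ (α_ (X ⊗ A) Y W).inv := by
  simp only [rightComm, BraidedCategory.braiding_tensor_left_hom]
  monoidal

theorem rightComm_associator (X Y W A : C) :
    (α_ X Y W).inv ▷ A ≫ rightComm (X ⊗ Y) W A ≫ (α_ X Y A).hom ▷ W =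
      (α_ X (Y ⊗ W) A).hom ≫ X ◁ rightComm Y W A ≫ (α_ X (Y ⊗ A) W).inv := by
  simp only [rightComm]
  monoidal

theorem braiding_rightComm (X Y Z : C) :
    (β_ (X ⊗ Y) Z).hom ≫ (α_ Z X Y).inv ≫ (β_ Z X).hom ▷ Y = rightComm X Y Z := by
  rw [BraidedCategory.braiding_tensor_left_hom]
  simp [rightComm, symmetry_whiskerRight]

end RightComm

section Coherence

variable {G : Type w} {C : Type u} [Category.{v} C] [MonoidalCategory C] [SymmetricCategory C]
  [MonoidalClosed C]

theorem shuffleHom_left (g : G → C) {Γ Δ E : List (Ty G)} (A : Ty G) (s : Shuffle Γ Δ E) :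
    shuffleHom g (.left A s) = (ctxSnoc g E A).hom ≫ (shuffleHom g s ▷ tyObj g A) ≫
      rightComm (ctxObj g Γ) (ctxObj g Δ) (tyObj g A) ≫ ((ctxSnoc g Γ A).inv ▷ ctxObj g Δ) := by
  simp only [rightComm, Category.assoc]
  rfl

theorem shuffleHom_right (g : G → C) {Γ Δ E : List (Ty G)} (A : Ty G) (s : Shuffle Γ Δ E) :
    shuffleHom g (.right A s) = (ctxSnoc g E A).hom ≫ (shuffleHom g s ▷ tyObj g A) ≫
        (α_ (ctxObj g Γ) (ctxObj g Δ) (tyObj g A)).hom ≫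
        (ctxObj g Γ ◁ (ctxSnoc g Δ A).inv) := rfl

/-- The symmetry of shuffles is interpreted as the braiding. -/
theorem shuffleHom_symm (g : G → C) {Γ Δ E : List (Ty G)} (s : Shuffle Γ Δ E) :
    shuffleHom g s.symm = shuffleHom g s ≫ (β_ (ctxObj g Γ) (ctxObj g Δ)).hom := by
  induction s with
  | nil =>
    change (λ_ (𝟙_ C)).inv = (λ_ (𝟙_ C)).inv ≫ (β_ (𝟙_ C) (𝟙_ C)).hom
    simp [braiding_tensorUnit_right, ← unitors_equal]
  | left A s ih =>
    simp only [Shuffle.symm, shuffleHom_left, shuffleHom_right, ih, Category.assoc,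
      comp_whiskerRight, BraidedCategory.braiding_naturality_left, reassoc_of% @rightComm_braiding]
  | right A s ih =>
    simp only [Shuffle.symm, shuffleHom_left, shuffleHom_right, ih, Category.assoc,
      comp_whiskerRight, BraidedCategory.braiding_naturality_right,
      reassoc_of% @associator_braiding_tensor]

theorem shuffleHom_allLeft (g : G → C) (Γ : List (Ty G)) :
    shuffleHom g (.allLeft Γ) = (ρ_ (ctxObj g Γ)).inv := by
  induction Γ with
  | nil => exact unitors_inv_equal
  | cons A Γ ih =>
    rw [Shuffle.allLeft, shuffleHom_left, ih]
    change (ctxSnoc g Γ A).hom ≫ (ρ_ (ctxObj g Γ)).inv ▷ tyObj g A ≫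
      rightComm (ctxObj g Γ) (𝟙_ C) (tyObj g A) ≫ (ctxSnoc g Γ A).inv ▷ (𝟙_ C) = _
    simp [rightComm, braiding_tensorUnit_left]

theorem shuffleHom_allRight (g : G → C) (Γ : List (Ty G)) :
    shuffleHom g (.allRight Γ) = (λ_ (ctxObj g Γ)).inv := by
  rw [← Shuffle.symm_allLeft, shuffleHom_symm, shuffleHom_allLeft]
  change _ ≫ (β_ (ctxObj g Γ) (𝟙_ C)).hom = _
  simp [braiding_tensorUnit_right]

theorem shuffleHom_last (g : G → C) (Γ : List (Ty G)) (A : Ty G) :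
    shuffleHom g (.last Γ A) = (ctxSnoc g Γ A).hom := by
  rw [Shuffle.last, shuffleHom_right, shuffleHom_allLeft]
  change (ctxSnoc g Γ A).hom ≫ (ρ_ (ctxObj g Γ)).inv ▷ tyObj g A ≫
    (α_ (ctxObj g Γ) (𝟙_ C) (tyObj g A)).hom ≫ ctxObj g Γ ◁ (λ_ (tyObj g A)).hom = _
  simp

theorem Shuffle.assoc_left {T : Type w} {Γ₁ Γ₂ Γ₃ Δ E : List T} (A : T) (s : Shuffle Γ₂ Γ₃ Δ)
    (t : Shuffle Γ₁ Δ E) :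
    Shuffle.assoc s (.left A t) =
      ⟨_, .left A (Shuffle.assoc s t).inner, .left A (Shuffle.assoc s t).outer⟩ := by
  cases s <;> rfl

/-- The reassociation of shuffles is interpreted as the associator. By recursion on the position
of the last variable of `E`: the three cases use `rightComm_tensor`, `rightComm_associator` and the
pentagon identity. -/
theorem shuffleHom_assoc (g : G → C) : {Γ₁ Γ₂ Γ₃ Δ E : List (Ty G)} →
    (s : Shuffle Γ₂ Γ₃ Δ) → (t : Shuffle Γ₁ Δ E) →
    shuffleHom g (Shuffle.assoc s t).outer ≫ shuffleHom g (Shuffle.assoc s t).inner ▷ ctxObj g Γ₃ =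
      shuffleHom g t ≫ ctxObj g Γ₁ ◁ shuffleHom g s ≫
        (α_ (ctxObj g Γ₁) (ctxObj g Γ₂) (ctxObj g Γ₃)).inv
  | _, _, _, _, _, .nil, .nil => by
    change (λ_ (𝟙_ C)).inv ≫ (λ_ (𝟙_ C)).inv ▷ (𝟙_ C) =
      (λ_ (𝟙_ C)).inv ≫ (𝟙_ C) ◁ (λ_ (𝟙_ C)).inv ≫ (α_ (𝟙_ C) (𝟙_ C) (𝟙_ C)).inv
    monoidal
  | _, Γ₂, Γ₃, Δ, _, s, .left (Γ := Γ₁) (E := E) A t => by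
    have ih := congrArg (· ▷ tyObj g A) (shuffleHom_assoc g s t)
    simp only [comp_whiskerRight] at ih
    rw [Shuffle.assoc_left]
    simp only [shuffleHom_left, comp_whiskerRight, Category.assoc, inv_hom_whiskerRight_assoc,
      ← reassoc_of% @rightComm_naturality_left]
    rw [reassoc_of% ih, reassoc_of% @rightComm_tensor, reassoc_of% @rightComm_naturality_middle,
      ← whisker_exchange_assoc, associator_inv_naturality_left]
  | Γ₁, _, Γ₃, _, _, .left (Γ := Γ₂) (E := Δ) _ s, .right (E := E) A t => by
    have ih := congrArg (· ▷ tyObj g A) (shuffleHom_assoc g s t)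
    simp only [comp_whiskerRight] at ih
    change shuffleHom g (Shuffle.left A (Shuffle.assoc s t).outer) ≫
      shuffleHom g (Shuffle.right A (Shuffle.assoc s t).inner) ▷ ctxObj g Γ₃ = _
    simp only [shuffleHom_left, shuffleHom_right, comp_whiskerRight, Category.assoc,
      inv_hom_whiskerRight_assoc, ← reassoc_of% @rightComm_naturality_left]
    rw [reassoc_of% ih, reassoc_of% @rightComm_associator]
    simp
  | Γ₁, Γ₂, _, _, _, .right (Δ := Γ₃) (E := Δ) _ s, .right (E := E) A t => by
    have ih := congrArg (· ▷ tyObj g A) (shuffleHom_assoc g s t)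
    simp only [comp_whiskerRight] at ih
    change shuffleHom g (Shuffle.right A (Shuffle.assoc s t).outer) ≫
      shuffleHom g (Shuffle.assoc s t).inner ▷ ctxObj g (A :: Γ₃) = _
    simp only [shuffleHom_right, Category.assoc, whisker_exchange,
      ← associator_naturality_left_assoc]
    rw [reassoc_of% ih]
    simp

end Coherence

/-! ### The interpretation of terms as morphisms -/

section Denotation

variable {G : Type w} {C : Type u} [Category.{v} C] [MonoidalCategory C] [MonoidalClosed C]

/-- The interpretation of the empty context is the unit object. This isomorphism and the next four
are identities, used to keep both sides of an equation of morphisms syntactically composable. -/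
def ctxNil (g : G → C) : ctxObj g [] ≅ 𝟙_ C := Iso.refl _

/-- The interpretation of a context with one variable. -/
def ctxSingle (g : G → C) (A : Ty G) : ctxObj g [A] ≅ tyObj g A := Iso.refl _

/-- The interpretation of the unit type. -/
def tyUnit (g : G → C) : tyObj g .unit ≅ 𝟙_ C := Iso.refl _

/-- The interpretation of a tensor type. -/
def tyTensor (g : G → C) (A B : Ty G) : tyObj g (.tensor A B) ≅ tyObj g A ⊗ tyObj g B :=
  Iso.refl _

/-- The interpretation of a function type. -/
def tyLolly (g : G → C) (A B : Ty G) :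
    tyObj g (.lolly A B) ≅ (ihom (tyObj g A)).obj (tyObj g B) :=
  Iso.refl _

theorem ctxSnoc_nil (g : G → C) (A : Ty G) :
    ctxSnoc g [] A = ctxSingle g A ≪≫ (λ_ (tyObj g A)).symm ≪≫
      whiskerRightIso (ctxNil g).symm (tyObj g A) := by
  ext
  change (λ_ (tyObj g A)).inv = 𝟙 (tyObj g A) ≫ (λ_ (tyObj g A)).inv ≫ 𝟙 (𝟙_ C) ▷ tyObj g A
  simp

variable [SymmetricCategory C]

/-- `shuffleHom_allLeft` with the target typed as `⟦Γ⟧ ⊗ ⟦[]⟧`. -/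
theorem shuffleHom_allLeft' (g : G → C) (Γ : List (Ty G)) :
    shuffleHom g (.allLeft Γ) = (ρ_ (ctxObj g Γ)).inv ≫ ctxObj g Γ ◁ (ctxNil g).inv := by
  rw [shuffleHom_allLeft]
  change (ρ_ (ctxObj g Γ)).inv = (ρ_ (ctxObj g Γ)).inv ≫ ctxObj g Γ ◁ 𝟙 (𝟙_ C)
  simp

/-- `shuffleHom_allRight` with the target typed as `⟦[]⟧ ⊗ ⟦Γ⟧`. -/
theorem shuffleHom_allRight' (g : G → C) (Γ : List (Ty G)) :
    shuffleHom g (.allRight Γ) = (λ_ (ctxObj g Γ)).inv ≫ (ctxNil g).inv ▷ ctxObj g Γ := by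
  rw [shuffleHom_allRight]
  change (λ_ (ctxObj g Γ)).inv = (λ_ (ctxObj g Γ)).inv ≫ 𝟙 (𝟙_ C) ▷ ctxObj g Γ
  simp

/-- `shuffleHom_last` with the target typed as `⟦Γ⟧ ⊗ ⟦[A]⟧`. -/
theorem shuffleHom_last' (g : G → C) (Γ : List (Ty G)) (A : Ty G) :
    shuffleHom g (.last Γ A) = (ctxSnoc g Γ A).hom ≫ ctxObj g Γ ◁ (ctxSingle g A).inv := by
  rw [shuffleHom_last]
  change (ctxSnoc g Γ A).hom = (ctxSnoc g Γ A).hom ≫ ctxObj g Γ ◁ 𝟙 (tyObj g A)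
  simp

variable {S : Signature G} (M : Interpretation S C)

/-- The interpretation of a term, typed by `tyObj` rather than by `Kind.obj`, so that it composes
syntactically with the structure morphisms of `C`. -/
def tmHom {Γ : List (Ty G)} {A : Ty G} (t : Tm S Γ A) : ctxObj M.ob Γ ⟶ tyObj M.ob A :=
  t.interp M

/-- The interpretation of a list of terms, typed by `ctxObj` rather than by `Kind.obj`. -/
def argsHom {E As : List (Ty G)} (σ : Args S E As) : ctxObj M.ob E ⟶ ctxObj M.ob As :=
  σ.interp M

theorem tmHom_hyp (A : Ty G) : tmHom M (.hyp (S := S) A) = (ctxSingle M.ob A).hom := rfl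

theorem tmHom_op {E : List (Ty G)} (f : S.Op) (vs : Args S E (S.dom f)) :
    tmHom M (.op f vs) = argsHom M vs ≫ M.op f := rfl

theorem tmHom_star : tmHom M (.star (S := S)) = (ctxNil M.ob).hom ≫ (tyUnit M.ob).inv :=
  (Category.comp_id (𝟙 (𝟙_ C))).symm

theorem tmHom_letStar {Γ Δ E : List (Ty G)} {A : Ty G} (v : Tm S Γ .unit) (w : Tm S Δ A)
    (s : Shuffle Γ Δ E) :
    tmHom M (.letStar v w s) = shuffleHom M.ob s ≫ ((tmHom M v ≫ (tyUnit M.ob).hom) ▷ _) ≫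
      (λ_ (ctxObj M.ob Δ)).hom ≫ tmHom M w := by
  have h : tmHom M v ≫ (tyUnit M.ob).hom = tmHom M v := Category.comp_id _
  rw [h]
  rfl

theorem tmHom_tensor {Γ Δ E : List (Ty G)} {A B : Ty G} (v : Tm S Γ A) (w : Tm S Δ B)
    (s : Shuffle Γ Δ E) :
    tmHom M (.tensor v w s) =
      shuffleHom M.ob s ≫ (tmHom M v ⊗ₘ tmHom M w) ≫ (tyTensor M.ob A B).inv := by
  have h : (tmHom M v ⊗ₘ tmHom M w) ≫ (tyTensor M.ob A B).inv = tmHom M v ⊗ₘ tmHom M w :=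
    Category.comp_id _
  rw [h]
  rfl

theorem tmHom_letPair {Γ Δ E : List (Ty G)} {A B D : Ty G} (v : Tm S Γ (.tensor A B))
    (w : Tm S (B :: A :: Δ) D) (s : Shuffle Γ Δ E) :
    tmHom M (.letPair v w s) =
      shuffleHom M.ob s ≫ ((tmHom M v ≫ (tyTensor M.ob A B).hom) ▷ ctxObj M.ob Δ) ≫
        (β_ (tyObj M.ob A ⊗ tyObj M.ob B) (ctxObj M.ob Δ)).hom ≫
        (α_ (ctxObj M.ob Δ) (tyObj M.ob A) (tyObj M.ob B)).inv ≫
        ((ctxSnoc M.ob Δ A).inv ▷ tyObj M.ob B) ≫ (ctxSnoc M.ob (A :: Δ) B).inv ≫ tmHom M w := by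
  have h : tmHom M v ≫ (tyTensor M.ob A B).hom = tmHom M v := Category.comp_id _
  rw [h]
  rfl

theorem tmHom_lam {Γ : List (Ty G)} {A B : Ty G} (v : Tm S (A :: Γ) B) :
    tmHom M (.lam v) =
      transpose ((ctxSnoc M.ob Γ A).inv ≫ tmHom M v) ≫ (tyLolly M.ob A B).inv :=
  (Category.comp_id (transpose ((ctxSnoc M.ob Γ A).inv ≫ tmHom M v))).symm

theorem tmHom_app {Γ Δ E : List (Ty G)} {A B : Ty G} (v : Tm S Γ (.lolly A B)) (w : Tm S Δ A)
    (s : Shuffle Γ Δ E) :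
    tmHom M (.app v w s) = shuffleHom M.ob s ≫
      ((tmHom M v ≫ (tyLolly M.ob A B).hom) ⊗ₘ tmHom M w) ≫
        appHom (tyObj M.ob A) (tyObj M.ob B) := by
  have h : tmHom M v ≫ (tyLolly M.ob A B).hom = tmHom M v := Category.comp_id _
  rw [h]
  rfl

theorem argsHom_nil : argsHom M (.nil (S := S)) = 𝟙 (ctxObj M.ob []) := rfl

theorem argsHom_snoc {Γ Δ E As : List (Ty G)} {A : Ty G} (vs : Args S Γ As) (v : Tm S Δ A)
    (s : Shuffle Γ Δ E) :
    argsHom M (.snoc vs v s) =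
      shuffleHom M.ob s ≫ (argsHom M vs ⊗ₘ tmHom M v) ≫ (ctxSnoc M.ob As A).inv := rfl

end Denotation

/-! ### Substitution is composition -/

section Substitution

variable {G : Type w} {C : Type u} [Category.{v} C] [MonoidalCategory C] [SymmetricCategory C]
  [MonoidalClosed C] {S : Signature G} (M : Interpretation S C)

/-- The reassociation that moves a term inserted on the right of `Θ` into the left part `Γ`, as in
the `left` case of `Expr.split`, is interpreted as `rightComm`. -/
theorem shuffleHom_assoc_symm_left (g : G → C) {Γ Δ Ξ Θ E : List (Ty G)} (p : Shuffle Γ Δ Θ)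
    (s : Shuffle Θ Ξ E) :
    shuffleHom g (Shuffle.assoc p s.symm).outer ≫
        shuffleHom g (Shuffle.assoc p s.symm).inner.symm ▷ ctxObj g Δ =
      shuffleHom g s ≫ shuffleHom g p ▷ ctxObj g Ξ ≫
        rightComm (ctxObj g Γ) (ctxObj g Δ) (ctxObj g Ξ) := by
  rw [shuffleHom_symm, comp_whiskerRight, reassoc_of% @shuffleHom_assoc, shuffleHom_symm]
  simp only [Category.assoc, ← BraidedCategory.braiding_naturality_left_assoc,
    braiding_rightComm]

/-- The reassociation that moves a term inserted on the right of `Θ` into the right part `Δ`, as in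
the `right` case of `Expr.split`, is interpreted as the associator. -/
theorem shuffleHom_assoc_symm_right (g : G → C) {Γ Δ Ξ Θ E : List (Ty G)} (p : Shuffle Γ Δ Θ)
    (s : Shuffle Θ Ξ E) :
    shuffleHom g (Shuffle.assoc p.symm s.symm).outer.symm ≫
        ctxObj g Γ ◁ shuffleHom g (Shuffle.assoc p.symm s.symm).inner.symm =
      shuffleHom g s ≫ shuffleHom g p ▷ ctxObj g Ξ ≫
        (α_ (ctxObj g Γ) (ctxObj g Δ) (ctxObj g Ξ)).hom := by
  rw [shuffleHom_symm g (Shuffle.assoc p.symm s.symm).outer, Category.assoc,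
    ← BraidedCategory.braiding_naturality_left, ← Category.assoc, shuffleHom_assoc_symm_left,
    shuffleHom_symm]
  simp only [comp_whiskerRight, Category.assoc, rightComm_braiding]
  rw [reassoc_of% @symmetry_whiskerRight]

/-- Splitting a list of terms along a shuffle is interpreted as shuffling its interpretation. -/
theorem argsHom_split : {Γ Δ Θ E : List (Ty G)} → (σ : Args S E Θ) → (s : Shuffle Γ Δ Θ) →
    argsHom M σ ≫ shuffleHom M.ob s =
      shuffleHom M.ob (σ.split s).shuffle ≫ (argsHom M (σ.split s).fst ⊗ₘ argsHom M (σ.split s).snd)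
  | _, _, _, _, .nil, .nil => by
    change 𝟙 _ ≫ (λ_ (𝟙_ C)).inv = (λ_ (𝟙_ C)).inv ≫ (𝟙 (𝟙_ C) ⊗ₘ 𝟙 (𝟙_ C))
    simp
  | _, _, _, _, .snoc (A := A) (Δ := Ξ) σ v s, .left (Γ := Γ) (Δ := Δ) _ t => by
    have ih := congrArg (· ⊗ₘ tmHom M v) (argsHom_split σ t)
    change _ = shuffleHom M.ob (Shuffle.assoc (σ.split t).shuffle s.symm).outer ≫
      (argsHom M (Expr.snoc (σ.split t).fst v
        (Shuffle.assoc (σ.split t).shuffle s.symm).inner.symm) ⊗ₘ argsHom M (σ.split t).snd)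
    rw [argsHom_snoc, argsHom_snoc, shuffleHom_left, ← whiskerRight_comp_tensorHom,
      reassoc_of% @shuffleHom_assoc_symm_left, ← tensorHom_comp_whiskerRight]
    rw [← tensorHom_comp_whiskerRight, ← whiskerRight_comp_tensorHom] at ih
    simp only [Category.assoc, Iso.inv_hom_id_assoc]
    rw [reassoc_of% ih, reassoc_of% @rightComm_naturality]
  | _, _, _, _, .snoc (A := A) (Δ := Ξ) σ v s, .right (Γ := Γ) (Δ := Δ) _ t => by
    have ih := congrArg (· ⊗ₘ tmHom M v) (argsHom_split σ t)
    change _ = shuffleHom M.ob (Shuffle.assoc (σ.split t).shuffle.symm s.symm).outer.symm ≫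
      (argsHom M (σ.split t).fst ⊗ₘ argsHom M (Expr.snoc (σ.split t).snd v
        (Shuffle.assoc (σ.split t).shuffle.symm s.symm).inner.symm))
    rw [argsHom_snoc, argsHom_snoc, shuffleHom_right, ← whiskerLeft_comp_tensorHom,
      reassoc_of% @shuffleHom_assoc_symm_right, ← tensorHom_comp_whiskerLeft]
    rw [← tensorHom_comp_whiskerRight, ← whiskerRight_comp_tensorHom] at ih
    simp only [Category.assoc, Iso.inv_hom_id_assoc]
    rw [reassoc_of% ih, associator_naturality_assoc]

/-- The only shuffle of the empty context with `Γ` is `allRight Γ`. -/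
theorem Shuffle.heq_allRight {T : Type w} : {Γ E : List T} → (s : Shuffle [] Γ E) →
    HEq s (Shuffle.allRight Γ)
  | _, _, .nil => HEq.rfl
  | _, _, .right A s => by
    obtain rfl := s.eq_of_nil_left
    have h := eq_of_heq s.heq_allRight
    rw [h]
    rfl

theorem tmHom_single {E : List (Ty G)} {A : Ty G} (σ : Args S E [A]) :
    tmHom M σ.single = argsHom M σ ≫ (ctxSingle M.ob A).hom := by
  cases σ with
  | snoc vs v s =>
    cases vs with
    | nil =>
      obtain rfl := s.eq_of_nil_left
      obtain rfl := eq_of_heq s.heq_allRight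
      rw [argsHom_snoc, shuffleHom_allRight', argsHom_nil, ctxSnoc_nil]
      change tmHom M v = _
      simp [tensorHom_def', whisker_exchange_assoc]

theorem argsHom_snoc_hyp {E As : List (Ty G)} (σ : Args S E As) (A : Ty G) :
    argsHom M (.snoc σ (.hyp A) (.last E A)) =
      (ctxSnoc M.ob E A).hom ≫ (argsHom M σ ▷ tyObj M.ob A) ≫ (ctxSnoc M.ob As A).inv := by
  rw [argsHom_snoc, shuffleHom_last, ← tensorHom_id]
  rfl

theorem argsHom_vars (Γ : List (Ty G)) :
    argsHom M (.vars (S := S) Γ) = 𝟙 (ctxObj M.ob Γ) := by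
  induction Γ with
  | nil => rfl
  | cons A Γ ih =>
    rw [Expr.vars, argsHom_snoc_hyp, ih]
    simp

theorem comp_transpose {X X' Y Z : C} (f : X' ⟶ X) (h : X ⊗ Y ⟶ Z) :
    f ≫ transpose h = transpose (f ▷ Y ≫ h) := by
  simp only [transpose, ← MonoidalClosed.curry_natural_left]
  rw [← BraidedCategory.braiding_naturality_right_assoc]

/-- Substitution is interpreted as composition. -/
theorem Expr.interp_subst : {Γ : List (Ty G)} → {J : Kind G} → (v : Expr S Γ J) →
    {E : List (Ty G)} → (σ : Args S E Γ) →
    (v.subst σ).interp M = argsHom M σ ≫ v.interp M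
  | _, _, .hyp A, _, σ => tmHom_single M σ
  | _, _, .op f vs, _, σ => by
    have ih : argsHom M (vs.subst σ) = argsHom M σ ≫ argsHom M vs := Expr.interp_subst vs σ
    change tmHom M (.op f (vs.subst σ)) = argsHom M σ ≫ tmHom M (.op f vs)
    rw [tmHom_op, tmHom_op, ih, Category.assoc]
  | _, _, .star, _, .nil => (Category.comp_id _).symm
  | _, _, .letStar v w s, _, σ => by
    have ih : tmHom M (v.subst _) = argsHom M _ ≫ tmHom M v :=
      Expr.interp_subst v (σ.split s).fst
    have ih' : tmHom M (w.subst _) = argsHom M _ ≫ tmHom M w :=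
      Expr.interp_subst w (σ.split s).snd
    change tmHom M (.letStar (v.subst (σ.split s).fst) (w.subst (σ.split s).snd)
      (σ.split s).shuffle) = argsHom M σ ≫ tmHom M (.letStar v w s)
    rw [tmHom_letStar, tmHom_letStar, ih, ih', ← Category.assoc (argsHom M σ), argsHom_split]
    simp [MonoidalCategory.tensorHom_def, whisker_exchange_assoc]
  | _, _, .tensor v w s, _, σ => by
    have ih : tmHom M (v.subst _) = argsHom M _ ≫ tmHom M v :=
      Expr.interp_subst v (σ.split s).fst
    have ih' : tmHom M (w.subst _) = argsHom M _ ≫ tmHom M w :=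
      Expr.interp_subst w (σ.split s).snd
    change tmHom M (.tensor (v.subst (σ.split s).fst) (w.subst (σ.split s).snd)
      (σ.split s).shuffle) = argsHom M σ ≫ tmHom M (.tensor v w s)
    rw [tmHom_tensor, tmHom_tensor, ih, ih', ← Category.assoc (argsHom M σ), argsHom_split]
    simp
  | _, _, .letPair (A := A) (B := B) v w s, _, σ => by
    have ih : tmHom M (v.subst _) = argsHom M _ ≫ tmHom M v :=
      Expr.interp_subst v (σ.split s).fst
    have ih' : tmHom M (w.subst _) = argsHom M _ ≫ tmHom M w := Expr.interp_subst w
      (.snoc (.snoc (σ.split s).snd (.hyp A) (.last _ A)) (.hyp B) (.last _ B))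
    change tmHom M (.letPair (v.subst (σ.split s).fst) (w.subst
      (.snoc (.snoc (σ.split s).snd (.hyp A) (.last _ A)) (.hyp B) (.last _ B)))
      (σ.split s).shuffle) = argsHom M σ ≫ tmHom M (.letPair v w s)
    rw [tmHom_letPair, tmHom_letPair, ih, ih', ← Category.assoc (argsHom M σ), argsHom_split,
      argsHom_snoc_hyp, argsHom_snoc_hyp]
    simp only [MonoidalCategory.tensorHom_def, Category.assoc, ← comp_whiskerRight_assoc,
      whisker_exchange_assoc, BraidedCategory.braiding_naturality_right_assoc, Iso.inv_hom_id_assoc]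
    simp
  | _, _, .lam (A := A) v, _, σ => by
    have ih : tmHom M (v.subst _) = argsHom M _ ≫ tmHom M v :=
      Expr.interp_subst v (.snoc σ (.hyp A) (.last _ A))
    change tmHom M (.lam (v.subst (.snoc σ (.hyp A) (.last _ A)))) = argsHom M σ ≫ tmHom M (.lam v)
    rw [tmHom_lam, tmHom_lam, ih, argsHom_snoc_hyp, reassoc_of% @comp_transpose]
    simp
  | _, _, .app v w s, _, σ => by
    have ih : tmHom M (v.subst _) = argsHom M _ ≫ tmHom M v :=
      Expr.interp_subst v (σ.split s).fst
    have ih' : tmHom M (w.subst _) = argsHom M _ ≫ tmHom M w :=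
      Expr.interp_subst w (σ.split s).snd
    change tmHom M (.app (v.subst (σ.split s).fst) (w.subst (σ.split s).snd)
      (σ.split s).shuffle) = argsHom M σ ≫ tmHom M (.app v w s)
    rw [tmHom_app, tmHom_app, ih, ih', ← Category.assoc (argsHom M σ), argsHom_split]
    simp
  | _, _, .nil, _, .nil => (Category.comp_id _).symm
  | _, _, .snoc vs v s, _, σ => by
    have ih : argsHom M (vs.subst _) = argsHom M _ ≫ argsHom M vs :=
      Expr.interp_subst vs (σ.split s).fst
    have ih' : tmHom M (v.subst _) = argsHom M _ ≫ tmHom M v :=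
      Expr.interp_subst v (σ.split s).snd
    change argsHom M (.snoc (vs.subst (σ.split s).fst) (v.subst (σ.split s).snd)
      (σ.split s).shuffle) = argsHom M σ ≫ argsHom M (.snoc vs v s)
    rw [argsHom_snoc, argsHom_snoc, ih, ih', ← Category.assoc (argsHom M σ), argsHom_split]
    simp

theorem tmHom_subst {Γ E : List (Ty G)} {A : Ty G} (v : Tm S Γ A) (σ : Args S E Γ) :
    tmHom M (v.subst σ) = argsHom M σ ≫ tmHom M v :=
  Expr.interp_subst M v σ

theorem tmHom_subst₁ {Γ Δ E : List (Ty G)} {A B : Ty G} (v : Tm S (A :: Γ) B) (w : Tm S Δ A)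
    (s : Shuffle Γ Δ E) :
    tmHom M (v.subst₁ w s) = shuffleHom M.ob s ≫ ctxObj M.ob Γ ◁ tmHom M w ≫
      (ctxSnoc M.ob Γ A).inv ≫ tmHom M v := by
  rw [Expr.subst₁, tmHom_subst, argsHom_snoc, argsHom_vars]
  simp

theorem tmHom_subst₂ {Γ Δ₁ Δ₂ E : List (Ty G)} {A B D : Ty G} (u : Tm S (B :: A :: Γ) D)
    (v : Tm S Δ₁ A) (w : Tm S Δ₂ B) (t : Shuffle.Three Γ Δ₁ Δ₂ E) :
    tmHom M (u.subst₂ v w t) = shuffleHom M.ob t.outer ≫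
      ((shuffleHom M.ob t.inner ≫ ctxObj M.ob Γ ◁ tmHom M v ≫ (ctxSnoc M.ob Γ A).inv) ⊗ₘ tmHom M w)
        ≫ (ctxSnoc M.ob (A :: Γ) B).inv ≫ tmHom M u := by
  rw [Expr.subst₂, tmHom_subst, argsHom_snoc, argsHom_snoc, argsHom_vars]
  simp

theorem argsHom_singleton {E : List (Ty G)} {A : Ty G} (t : Tm S E A) :
    argsHom M (.snoc .nil t (.allRight E)) = tmHom M t ≫ (ctxSingle M.ob A).inv := by
  have h := tmHom_single M (.snoc .nil t (.allRight E))
  rw [← cancel_mono (ctxSingle M.ob A).hom, ← h]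
  simp only [Category.assoc, Iso.inv_hom_id, Category.comp_id]
  rfl

theorem tmHom_comp {A A' A'' : Ty G} (v : Tm S [A'] A'') (w : Tm S [A] A') :
    tmHom M (v.comp w) = tmHom M w ≫ (ctxSingle M.ob A').inv ≫ tmHom M v := by
  change tmHom M (v.subst (.snoc .nil w (.allRight [A]))) = _
  rw [tmHom_subst, argsHom_singleton, Category.assoc]

end Substitution

/-! ### Soundness of the equations of linear `λ`-calculus -/

section Equations

variable {G : Type w} {C : Type u} [Category.{v} C] [MonoidalCategory C] [SymmetricCategory C]
  [MonoidalClosed C]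

theorem transpose_whiskerRight_appHom {X Y Z : C} (f : X ⊗ Y ⟶ Z) :
    transpose f ▷ Y ≫ appHom Y Z = f := by
  rw [appHom, BraidedCategory.braiding_naturality_left_assoc, transpose,
    ← MonoidalClosed.uncurry_eq, MonoidalClosed.uncurry_curry]
  simp

theorem transpose_appHom {X Y Z : C} (g : X ⟶ (ihom Y).obj Z) :
    transpose (g ▷ Y ≫ appHom Y Z) = g := by
  rw [transpose, appHom, ← BraidedCategory.braiding_naturality_right_assoc,
    SymmetricCategory.symmetry_assoc, ← MonoidalClosed.uncurry_eq, MonoidalClosed.curry_uncurry]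

theorem shuffleHom_symm_whiskerRight_braiding (g : G → C) {Γ Δ E : List (Ty G)}
    (s : Shuffle Γ Δ E) {X : C} (f : ctxObj g Δ ⟶ X) :
    shuffleHom g s.symm ≫ f ▷ ctxObj g Γ ≫ (β_ X (ctxObj g Γ)).hom =
      shuffleHom g s ≫ ctxObj g Γ ◁ f := by
  rw [BraidedCategory.braiding_naturality_left, shuffleHom_symm]
  simp

theorem shuffleHom_symm_whiskerRight_leftUnitor (g : G → C) {Γ Δ E : List (Ty G)}
    (s : Shuffle Γ Δ E) (f : ctxObj g Δ ⟶ 𝟙_ C) :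
    shuffleHom g s.symm ≫ f ▷ ctxObj g Γ ≫ (λ_ (ctxObj g Γ)).hom =
      shuffleHom g s ≫ ctxObj g Γ ◁ f ≫ (ρ_ (ctxObj g Γ)).hom := by
  rw [← braiding_rightUnitor, reassoc_of% @shuffleHom_symm_whiskerRight_braiding]

variable {S : Signature G} (M : Interpretation S C)

/-- The equations of linear `λ`-calculus hold in every autonomous category. -/
theorem tmHom_eq_of_eqn {Γ : List (Ty G)} {A : Ty G} {v w : Tm S Γ A} (h : Eqn v w) :
    tmHom M v = tmHom M w := by
  induction h with
  | pair_beta v w u s t =>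
    rw [tmHom_letPair, tmHom_tensor, tmHom_subst₂, ← whiskerRight_comp_tensorHom_assoc,
      reassoc_of% @shuffleHom_assoc, shuffleHom_symm]
    simp only [Category.assoc, Iso.inv_hom_id, Category.comp_id,
      BraidedCategory.braiding_naturality_left_assoc]
    simp [MonoidalCategory.tensorHom_def, ← whisker_exchange_assoc]
  | pair_eta v u t =>
    rw [tmHom_letPair, tmHom_subst₁, tmHom_subst₁, tmHom_tensor, shuffleHom_right, shuffleHom_last',
      shuffleHom_last', tmHom_hyp, tmHom_hyp, shuffleHom_symm]
    simp only [Category.assoc, BraidedCategory.braiding_naturality_left_assoc]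
    simp [tensorHom_def']
  | unit_beta v =>
    rw [tmHom_letStar, tmHom_star, shuffleHom_allRight']
    simp
  | @unit_eta Δ Γ E A v w t =>
    have h : (tyUnit M.ob).hom ▷ ctxObj M.ob Γ ≫ (λ_ (ctxObj M.ob Γ)).hom =
        (β_ _ (ctxObj M.ob Γ)).hom ≫ ctxObj M.ob Γ ◁ (tyUnit M.ob).hom ≫ (ρ_ _).hom := by
      rw [← BraidedCategory.braiding_naturality_left_assoc, braiding_rightUnitor]
    rw [tmHom_letStar, tmHom_subst₁, tmHom_subst₁, tmHom_star, shuffleHom_allLeft', shuffleHom_symm]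
    simp [reassoc_of% h]
  | lam_beta v w t =>
    rw [tmHom_app, tmHom_lam, tmHom_subst₁]
    simp [tensorHom_def', transpose_whiskerRight_appHom]
  | lam_eta v =>
    rw [tmHom_lam, tmHom_app, tmHom_hyp, shuffleHom_last', tensorHom_def']
    simp only [Category.assoc, Iso.inv_hom_id_assoc, whiskerLeft_inv_hom_assoc, transpose_appHom,
      Iso.hom_inv_id, Category.comp_id]
  | letStar_comm u v w s t =>
    -- Both sides are brought to the form `⟦t⟧ ≫ ⟦Γ⟧ ◁ ⟦s⟧ ≫ ⟦Γ⟧ ◁ (β_ _ _).hom ≫ …`.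
    rw [tmHom_subst₁, tmHom_letStar, tmHom_letStar, tmHom_subst₁,
      reassoc_of% @shuffleHom_symm_whiskerRight_leftUnitor, ← rightUnitor_naturality_assoc,
      whisker_exchange_assoc, reassoc_of% @shuffleHom_assoc, shuffleHom_symm,
      ← braiding_rightUnitor_assoc]
    simp only [comp_whiskerRight, Category.assoc, BraidedCategory.braiding_naturality_left_assoc]
    simp
  | letPair_comm u v w s t =>
    rw [tmHom_subst₁, tmHom_letPair, tmHom_letPair, tmHom_subst₁, shuffleHom_right,
      shuffleHom_right, reassoc_of% @shuffleHom_symm_whiskerRight_braiding]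
    simp only [comp_whiskerRight, Category.assoc, inv_hom_whiskerRight_assoc, Iso.inv_hom_id_assoc,
      ← associator_inv_naturality_left_assoc, whisker_exchange_assoc]
    rw [reassoc_of% @shuffleHom_assoc, shuffleHom_symm]
    simp only [BraidedCategory.braiding_naturality_left_assoc]
    simp

end Equations

/-! ### Soundness of the `V`-congruence rules -/

section Soundness

variable {V : Type*} [CommMonoid V] [CompleteLattice V] [IsQuantale V] {C : Type u}
  [Category.{v} C]

theorem dist_comp_le [VCatSepEnriched V C] {X Y Z : C} (f f' : X ⟶ Y) (g g' : Y ⟶ Z) :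
    VCat.dist (V := V) f f' * VCat.dist g g' ≤ VCat.dist (f ≫ g) (f' ≫ g') :=
  VCatSepEnriched.comp_isVFunctor X Y Z (f, g) (f', g')

theorem dist_comp_left_le [VCatSepEnriched V C] {X Y Z : C} (f : X ⟶ Y) (g g' : Y ⟶ Z) :
    VCat.dist (V := V) g g' ≤ VCat.dist (f ≫ g) (f ≫ g') := by
  simpa using (vmul_le_vmul (VCat.one_le_dist (V := V) f) le_rfl).trans (dist_comp_le f f g g')

theorem dist_comp_right_le [VCatSepEnriched V C] {X Y Z : C} (f f' : X ⟶ Y) (g : Y ⟶ Z) :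
    VCat.dist (V := V) f f' ≤ VCat.dist (f ≫ g) (f' ≫ g) := by
  simpa using (vmul_le_vmul le_rfl (VCat.one_le_dist (V := V) g)).trans (dist_comp_le f f' g g)

variable [MonoidalCategory C] [SymmetricCategory C] [MonoidalClosed C]

theorem le_dist_tensorHom [VCatSepAutonomous V C] {X X' Y Y' : C} {q r : V} {f f' : X ⟶ X'}
    {g g' : Y ⟶ Y'} (h : q ≤ VCat.dist f f') (h' : r ≤ VCat.dist g g') :
    q * r ≤ VCat.dist (f ⊗ₘ g) (f' ⊗ₘ g') :=
  (vmul_le_vmul h h').trans (VCatSepAutonomous.tensor_isVFunctor X X' Y Y' (f, g) (f', g'))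

variable {G : Type w} {S : Signature G} (M : Interpretation S C)

/-- Soundness: a theorem of a theory whose axioms are satisfied in `C` is satisfied in `C`. The
equations with label `⊤` are sound by integrality, and the rule `arch` because the labels in `B`
way below `q` have join `q`. -/
theorem VTheory.Thm.le_dist [VCatSepAutonomous V C] (integral : (1 : V) = ⊤) {B : Set V}
    (hB : IsLatticeBasis B) {T : VTheory S B}
    (hT : ∀ {Γ : List (Ty G)} {A : Ty G} {q : V} {v w : Tm S Γ A}, T.Ax q v w →
      M.Satisfies V q v w) {Γ : List (Ty G)} {J : Kind G} {q : V} {v w : Expr S Γ J}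
    (h : T.Thm q v w) : q ≤ VCat.dist (v.interp M) (w.interp M) := by
  induction h with
  | ax h => exact hT h
  | eqn h =>
    rw [show Expr.interp M _ = Expr.interp M _ from tmHom_eq_of_eqn M h, ← integral]
    exact VCat.one_le_dist _
  | eqn_symm h =>
    rw [show Expr.interp M _ = Expr.interp M _ from tmHom_eq_of_eqn M h, ← integral]
    exact VCat.one_le_dist _
  | refl v => exact integral.symm.trans_le (VCat.one_le_dist _)
  | trans _ _ ih ih' => exact (vmul_le_vmul ih ih').trans (VCat.dist_mul_dist_le _ _ _)
  | weak _ _ hrq ih => exact hrq.trans ih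
  | arch hq _ ih => exact (hB _).2.2.2 fun r hr => ih r hr.1 hr.2
  | join s _ ih => exact Finset.sup_le ih
  | args_nil => exact VCat.one_le_dist _
  | args_snoc s _ _ ih ih' =>
    exact (le_dist_tensorHom ih ih').trans
      ((dist_comp_right_le _ _ _).trans (dist_comp_left_le _ _ _))
  | op f _ ih => exact ih.trans (dist_comp_right_le _ _ _)
  | tensor s _ _ ih ih' => exact (le_dist_tensorHom ih ih').trans (dist_comp_left_le _ _ _)
  | letPair s _ _ ih ih' =>
    refine le_trans ?_ (dist_comp_left_le _ _ _)
    refine (vmul_le_vmul (ih.trans (VCatSepAutonomous.whiskerRight_isVFunctor _ _ _ _ _))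
      (ih'.trans ?_)).trans (dist_comp_le _ _ _ _)
    exact (dist_comp_left_le _ _ _).trans ((dist_comp_left_le _ _ _).trans
      ((dist_comp_left_le _ _ _).trans (dist_comp_left_le _ _ _)))
  | letStar s _ _ ih ih' =>
    refine le_trans ?_ (dist_comp_left_le _ _ _)
    exact (vmul_le_vmul (ih.trans (VCatSepAutonomous.whiskerRight_isVFunctor _ _ _ _ _))
      (ih'.trans (dist_comp_left_le _ _ _))).trans (dist_comp_le _ _ _ _)
  | lam _ ih =>
    exact (ih.trans (dist_comp_left_le _ _ _)).trans
      (VCatSepAutonomous.transpose_isVFunctor _ _ _ _ _)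
  | app s _ _ ih ih' =>
    exact (le_dist_tensorHom ih ih').trans
      ((dist_comp_right_le _ _ _).trans (dist_comp_left_le _ _ _))
  | exchange p _ ih =>
    rw [Expr.exchange, Expr.exchange, Expr.interp_subst, Expr.interp_subst]
    exact ih.trans (dist_comp_left_le _ _ _)
  | subst s _ _ ih ih' =>
    rw [Expr.subst₁, Expr.subst₁, Expr.interp_subst, Expr.interp_subst, mul_comm]
    -- `⟦v[w/x]⟧` is `⟦v⟧` precomposed with `⟦s⟧ ≫ (𝟙 ⊗ₘ ⟦w⟧)`, up to an isomorphism.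
    refine (vmul_le_vmul ?_ ih).trans (dist_comp_le _ _ _ _)
    refine le_trans ?_ ((dist_comp_right_le _ _ _).trans (dist_comp_left_le _ _ _))
    simpa using le_dist_tensorHom (VCat.one_le_dist _) ih'

end Soundness

/-! ### The syntactic category of the internal language -/

section InternalLanguage

variable {V : Type w} [CommMonoid V] [CompleteLattice V] [IsQuantale V]
  (C : Type u) [Category.{v} C] [MonoidalCategory C] [SymmetricCategory C] [MonoidalClosed C]

/-- Completeness: the labels in `B` way below the distance of two interpretations are labels of
axioms, and their join is this distance. -/
theorem Lang.dist_interp_le [VCatSepEnriched V C] {B : Set V} (hB : IsLatticeBasis B) {A A' : Ty C}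
    (t t' : (Lang C B).Values A A') :
    VCat.dist (V := V) (tmHom (langInterpretation C) t) (tmHom (langInterpretation C) t') ≤
      VCat.dist t t' :=
  (hB _).2.2.2 fun _ hr => le_sSup (.ax ⟨hr.1, (hB _).2.2.1 hr⟩)

/-- The term `f(t)`, for a morphism `f` of `C`. -/
def Lang.morTm {E : List (Ty C)} {X Y : C} (f : X ⟶ Y) (t : Tm (langSignature C) E (.ground X)) :
    Tm (langSignature C) E (.ground Y) :=
  .op (S := langSignature C) (.mor f) (.snoc .nil t (.allRight E))

/-- The term `t : A` transported along the symbol `A → i(A)`. -/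
def Lang.toObjTm {E : List (Ty C)} {A : Ty C} (t : Tm (langSignature C) E A) :
    Tm (langSignature C) E (.ground (tyObj id A)) :=
  .op (S := langSignature C) (.toObj A) (.snoc .nil t (.allRight E))

/-- The term `t : i(A)` transported along the symbol `i(A) → A`. -/
def Lang.ofObjTm {E : List (Ty C)} {A : Ty C}
    (t : Tm (langSignature C) E (.ground (tyObj id A))) : Tm (langSignature C) E A :=
  .op (S := langSignature C) (.ofObj A) (.snoc .nil t (.allRight E))

/-- The morphism `f : i(A) ⟶ i(A')` of `C` as a term of type `A'` in a variable of type `A`. -/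
def Lang.ofMor {A A' : Ty C} (f : tyObj id A ⟶ tyObj (id : C → C) A') :
    Tm (langSignature C) [A] A' :=
  ofObjTm C (morTm C f (toObjTm C (.hyp A)))

theorem Lang.tmHom_ofMor {A A' : Ty C} (f : tyObj id A ⟶ tyObj (id : C → C) A') :
    tmHom (langInterpretation C) (Lang.ofMor C f) = f := by
  -- `⟦[A]⟧` is `⟦A⟧` by definition, so that the singleton list of `t` is interpreted as `t`.
  have h : ∀ {A D : Ty C} (t : Tm (langSignature C) [D] A),
      argsHom (langInterpretation C) (.snoc .nil t (.allRight [D])) =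
        tmHom (langInterpretation C) t := fun t =>
    (argsHom_singleton _ t).trans (Category.comp_id _)
  have h₁ : tmHom (langInterpretation C) (toObjTm C (.hyp A)) = 𝟙 (tyObj id A) :=
    (Category.comp_id _).trans (h (.hyp A))
  have h₂ : tmHom (langInterpretation C) (morTm C f (toObjTm C (.hyp A))) = f :=
    (congrArg (· ≫ f) ((h (toObjTm C (.hyp A))).trans h₁)).trans (Category.id_comp f)
  exact (Category.comp_id _).trans ((h (morTm C f _)).trans h₂)

variable [VCatSepAutonomous V C] {B : Set V}

/-- The distance of two terms in the syntactic category is the distance of their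
interpretations. -/
theorem Lang.dist_eq (integral : (1 : V) = ⊤) (hB : IsLatticeBasis B) {A A' : Ty C}
    (t t' : (Lang C B).Values A A') :
    VCat.dist (V := V) t t' =
      VCat.dist (tmHom (langInterpretation C) t) (tmHom (langInterpretation C) t') :=
  le_antisymm
    (sSup_le fun _ h => h.le_dist (langInterpretation C) integral hB And.right)
    (Lang.dist_interp_le C hB t t')

/-- The interpretation of terms as a functor from the syntactic category of the internal language
of `C` to `C`. -/
def Lang.interpFunctor (integral : (1 : V) = ⊤) (hB : IsLatticeBasis B) :
    Syn (Lang C B) ⥤ C where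
  obj X := tyObj id X.ty
  map {X Y} := Quotient.lift (s := VCat.setoid V ((Lang C B).Values X.ty Y.ty))
    (fun t => tmHom (langInterpretation C) t) fun t t' h =>
      VCatSepEnriched.separated (V := V) _ _ _ _
        (h.1.trans_eq (Lang.dist_eq C integral hB t t'))
        (h.2.trans_eq (Lang.dist_eq C integral hB t' t))
  map_id X := rfl
  map_comp f g := by
    induction f using Quotient.ind with
    | _ t =>
    induction g using Quotient.ind with
    | _ t' =>
    change tmHom (langInterpretation C) (Expr.comp (S := langSignature C) t' t) =
      tmHom (langInterpretation C) t ≫ tmHom (langInterpretation C) t'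
    exact (tmHom_comp _ t' t).trans (congrArg (_ ≫ ·) (Category.id_comp _))

variable (integral : (1 : V) = ⊤) (hB : IsLatticeBasis B)

/-- The interpretation functor is an isometry on hom-objects. -/
theorem Lang.dist_interpFunctor_map {X Y : Syn (Lang C B)} (f g : X ⟶ Y) :
    VCat.dist (V := V) ((Lang.interpFunctor C integral hB).map f)
      ((Lang.interpFunctor C integral hB).map g) = VCat.dist f g := by
  induction f using Quotient.ind with
  | _ t =>
  induction g using Quotient.ind with
  | _ t' => exact (Lang.dist_eq C integral hB t t').symm

instance Lang.interpFunctor_faithful : (Lang.interpFunctor C integral hB).Faithful where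
  map_injective {X Y} f g h := by
    refine VCatSepEnriched.separated (V := V) X Y f g ?_ ?_ <;>
    · rw [← Lang.dist_interpFunctor_map C integral hB, h]
      exact VCat.one_le_dist _

instance Lang.interpFunctor_full : (Lang.interpFunctor C integral hB).Full where
  map_surjective f := ⟨(Lang C B).cls (Lang.ofMor C f), Lang.tmHom_ofMor C f⟩

instance Lang.interpFunctor_essSurj : (Lang.interpFunctor C integral hB).EssSurj where
  mem_essImage X := ⟨⟨.ground X⟩, ⟨Iso.refl _⟩⟩

instance Lang.interpFunctor_isEquivalence :
    (Lang.interpFunctor C integral hB).IsEquivalence where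

end InternalLanguage

/-- If an equivalence is an isometry on hom-objects, then its inverse is enriched: the image of
`F.inv.map k` under `F` is `k` composed with two fixed isomorphisms. -/
theorem isVCatFunctor_inv {V : Type w} [CommMonoid V] [CompleteLattice V] [IsQuantale V]
    {C D : Type*} [Category C] [Category D] [VCatSepEnriched V C] [VCatSepEnriched V D]
    (F : C ⥤ D) [F.IsEquivalence] (hF : ∀ {X Y : C} (f g : X ⟶ Y),
      VCat.dist (V := V) (F.map f) (F.map g) = VCat.dist f g) :
    IsVCatFunctor V F.inv := by
  intro X Y f g
  have h : ∀ k : X ⟶ Y, F.map (F.inv.map k) =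
      F.asEquivalence.counit.app X ≫ k ≫ F.asEquivalence.counitInv.app Y :=
    fun k => F.asEquivalence.fun_inv_map _ _ k
  rw [← hF, h, h]
  exact (dist_comp_right_le f g _).trans (dist_comp_left_le _ _ _)

end VLam

theorem mainTheorem2 {V : Type w} [CommMonoid V] [CompleteLattice V] [IsQuantale V]
    (integral : (1 : V) = ⊤) (continuous : VLam.IsContinuousLattice V)
    (B : Set V) (hB : VLam.IsQuantaleBasis B)
    (C : Type u) [Category.{v} C] [MonoidalCategory C] [SymmetricCategory C] [MonoidalClosed C]
    [VLam.VCatSepAutonomous V C] :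
    LocallySmall.{v} (VLam.Syn (VLam.Lang C B)) ∧
      Nonempty (VLam.VCatSepEquivalence V (VLam.Syn (VLam.Lang C B)) C) := by
  let F := VLam.Lang.interpFunctor C integral hB.basis
  have hF : ∀ {X Y : VLam.Syn (VLam.Lang C B)} (f g : X ⟶ Y),
      VLam.VCat.dist (V := V) (F.map f) (F.map g) = VLam.VCat.dist f g :=
    VLam.Lang.dist_interpFunctor_map C integral hB.basis
  exact ⟨⟨fun X Y => small_of_injective F.map_injective⟩,
    ⟨⟨F.asEquivalence, fun X Y f g => (hF f g).ge, VLam.isVCatFunctor_inv F hF⟩⟩⟩
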